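/- Let $X_1,X_2,\dots$ be real random variables on a probability space and $S_N=\sum_{n=1}^N X_n$. Suppose there are a complex Banach space $\mathbf B$, bounded linear operators $\mathcal L_t:\mathbf B\to\mathbf B$ $(t\in\mathbb R)$, a vector $v\in\mathbf B$ and a bounded linear functional $\ell\in\mathbf B'$ such that $$\mathbb E\big(e^{itS_N}\big)=\ell(\mathcal L_t^N v)\qquad\text{for all } t\in\mathbb R,\ N\ge 1 .$$ Assume the following for some integer $s\ge 3$. (A1) The map $t\mapsto\mathcal L_t$ is continuous in operator norm, and there is $\delta>0$ such that it is $s$ times continuously differentiable for $|t|\le\delta$. (A2) $1$ is an isolated point of the spectrum of $\mathcal L_0$ and a simple eigenvalue of $\mathcal L_0$ (algebraic multiplicity one), all other eigenvalues of $\mathcal L_0$ have absolute value less than $1$, and the essential spectrum of $\mathcal L_0$ (the set of $z\in\mathbb C$ for which $z-\mathcal L_0$ is not Fredholm) is contained in the open unit disk. (A3) For every $t\ne 0$, the spectrum of $\mathcal L_t$ is contained in $\{|z|<1\}$. Then there are $A\in\mathbb R$ and $\sigma^2\ge 0$ such that $\frac{S_N-NA}{\sqrt N}$ converges in distribution to $\mathcal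 N(0,\sigma^2)$ (the point mass at $0$ if $\sigma^2=0$). If $\sigma^2>0$, then $S_N$ admits the Edgeworth expansion of order $1$: there is a polynomial $P_1$ with real coefficients such that, uniformly in $z\in\mathbb R$, $$\mathbb P\left(\frac{S_N-NA}{\sqrt N}\le z\right)-\mathfrak N(z)=\frac{P_1(z)}{N^{1/2}}\,\mathfrak n(z)+o\big(N^{-1/2}\big)\qquad (N\to\infty),$$ where $\mathfrak n(y)=\frac1{\sqrt{2\pi\sigma^2}}e^{-y^2/(2\sigma^2)}$ and $\mathfrak N(z)=\int_{-\infty}^z\mathfrak n(y)\,dy$. -/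

import Mathlib

open MeasureTheory ProbabilityTheory Filter Topology
open scoped NNReal

noncomputable section

namespace Edgeworth

section Operators

variable {B : Type*} [NormedAddCommGroup B] [NormedSpace ℂ B]

/-- The (Fredholm) essential spectrum of a bounded operator: all complex `z` for which `z - T` is
not a Fredholm operator. -/
def essentialSpectrum (T : B →L[ℂ] B) : Set ℂ :=
  {z : ℂ | ¬ (z • ContinuousLinearMap.id ℂ B - T).IsFredholm}

/-- `z` is a simple eigenvalue of `T`: its algebraic multiplicity, that is, the dimension of the
space of all generalized eigenvectors, is one. -/
def IsSimpleEigenvalue (T : B →L[ℂ] B) (z : ℂ) : Prop :=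
  Module.finrank ℂ (Module.End.maxGenEigenspace (T : B →ₗ[ℂ] B) z) = 1

/-- (A1): `t ↦ L t` is continuous in operator norm, and for some `δ > 0` it is `s` times
continuously differentiable on `[-δ, δ]`. -/
structure AssumptionA1 (L : ℝ → B →L[ℂ] B) (s : ℕ) : Prop where
  continuous : Continuous L
  smooth : ∃ δ : ℝ, 0 < δ ∧ ContDiffOn ℝ s L (Set.Icc (-δ) δ)

/-- (A2), the spectral gap of `L 0`. -/
structure AssumptionA2 (L : ℝ → B →L[ℂ] B) : Prop where
  isolated : ¬ AccPt (1 : ℂ) (𝓟 (spectrum ℂ (L 0)))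
  simple : IsSimpleEigenvalue (L 0) 1
  norm_lt_one : ∀ z : ℂ, Module.End.HasEigenvalue (L 0 : B →ₗ[ℂ] B) z → z ≠ 1 → ‖z‖ < 1
  essentialSpectrum_subset : essentialSpectrum (L 0) ⊆ Metric.ball 0 1

/-- (A3): for `t ≠ 0` the spectrum of `L t` lies in the open unit disk. -/
def AssumptionA3 (L : ℝ → B →L[ℂ] B) : Prop :=
  ∀ t : ℝ, t ≠ 0 → spectrum ℂ (L t) ⊆ Metric.ball 0 1

end Operators

section RandomVariables

variable {Ω : Type*}

/-- `S_N = X_1 + ⋯ + X_N`. -/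
def partialSum (X : ℕ → Ω → ℝ) (N : ℕ) (ω : Ω) : ℝ :=
  ∑ n ∈ Finset.Icc 1 N, X n ω

/-- `(S_N - N A) / √N`. -/
def normalizedSum (X : ℕ → Ω → ℝ) (A : ℝ) (N : ℕ) (ω : Ω) : ℝ :=
  (partialSum X N ω - N * A) / √(N : ℝ)

variable [MeasurableSpace Ω]

/-- `E(exp(i t S_N)) = ℓ((L t)^N v)` for all real `t` and all `N ≥ 1`. -/
def CodesCharFun {B : Type*} [NormedAddCommGroup B] [NormedSpace ℂ B]
    (P : Measure Ω) (X : ℕ → Ω → ℝ) (L : ℝ → B →L[ℂ] B) (v : B) (ℓ : B →L[ℂ] ℂ) : Prop :=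
  ∀ N : ℕ, 1 ≤ N → ∀ t : ℝ,
    ∫ ω, Complex.exp (Complex.I * t * partialSum X N ω) ∂P = ℓ ((L t ^ N) v)

/-- `(S_N - N A) / √N` converges in distribution to the centred normal law with variance `var`
(the point mass at `0` if `var = 0`). -/
def SatisfiesCLT (P : Measure Ω) [IsProbabilityMeasure P] (X : ℕ → Ω → ℝ) (A : ℝ) (var : ℝ≥0) :
    Prop :=
  TendstoInDistribution (normalizedSum X A) atTop (id : ℝ → ℝ) (fun _ ↦ P) (gaussianReal 0 var)

/-- The sums `S_N`, with centring `A` and limit variance `var > 0`, admit the Edgeworth expansion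
of order `r`: there are real polynomials `Q 1, …, Q r` such that
`P((S_N - N A) / √N ≤ z) - 𝔑(z) = ∑_{p=1}^r N^{-p/2} Q_p(z) 𝔫(z) + o(N^{-r/2})`, uniformly in
`z ∈ ℝ`, where `𝔫` and `𝔑` are the density and the distribution function of the centred normal law
with variance `var`. -/
def AdmitsEdgeworthExpansion (P : Measure Ω) (X : ℕ → Ω → ℝ) (A : ℝ) (var : ℝ≥0) (r : ℕ) : Prop :=
  ∃ Q : ℕ → Polynomial ℝ, ∀ ε : ℝ, 0 < ε → ∀ᶠ N : ℕ in atTop, ∀ z : ℝ,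
    |P.real {ω | normalizedSum X A N ω ≤ z} - (∫ y in Set.Iic z, gaussianPDFReal 0 var y)
        - ∑ p ∈ Finset.Icc 1 r,
            (Q p).eval z / (N : ℝ) ^ ((p : ℝ) / 2) * gaussianPDFReal 0 var z|
      ≤ ε * (N : ℝ) ^ (-(r : ℝ) / 2)

end RandomVariables

end Edgeworth

end

noncomputable section

namespace Edgeworth

/-! ### Spectrum on and outside the unit circle -/

section Spectral

variable {B : Type*} [NormedAddCommGroup B] [NormedSpace ℂ B] [CompleteSpace B]

/-! The method is Nagaev–Guivarc'h: the characteristic function of `S_N` behaves like that of an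
i.i.d. sum with the leading eigenvalue of `L t` in place of the characteristic function of one
summand.

Operator side. Under (A2) the operator `L 0` is a rank-one projection plus a part of spectral radius
less than one. The implicit function theorem continues the eigenvalue and its projection to small
`t` with three derivatives (`exists_contDiffAt_eigenvalue`). Hence `ℓ (L t ^ N v) = λ(t)^N g(t)` up
to an exponentially small error, which at `t = 0` can only be zero, so the error is even `O(|t|
ρ^N)` (`exists_spectral_expansion`). On compact sets away from `0`, (A3) and Gelfand's formula give
exponential decay (`exists_exponential_decay`).

Scalar side. Since `λ^N g` shadows characteristic functions, `|λ| ≤ 1` and both `λ` and `g` are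
Hermitian near `0`. This makes the Taylor data real: `λ(t) e^{-iAt} = exp(-Vt²/2 + ict³) + o(t³)`
with `V ≥ 0`, and `g(t) = 1 + ibt + o(t)` (`exists_gaussian_expansion`, `exists_linear_expansion`).
At `t = τ/√N` the first expansion yields convergence of characteristic functions, hence the CLT by
Lévy's theorem.

Edgeworth expansion. For `V > 0` the normalized characteristic function is compared with `e^{-Vτ²/2}
(1 + i(bτ + cτ³)/√N)`, the transform of an explicit density `𝔫 + q/√N`. Esseen's inequality
(`exists_esseen_const`, proved with the Fejér kernel) with cutoff `T√N` bounds the error by `o(1/√N)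
+ O(1/(T√N))`. As `T` is an arbitrary constant, this is `o(1/√N)`; no control of frequencies beyond
compact sets is required. -/

theorem isUnit_of_boundedBelow_of_frequently {T : B →L[ℂ] B} {z : ℂ} {c : ℝ} (hc : 0 < c)
    (hb : ∀ x, c * ‖x‖ ≤ ‖(algebraMap ℂ (B →L[ℂ] B) z - T) x‖)
    (hz : ∃ᶠ w in 𝓝 z, IsUnit (algebraMap ℂ (B →L[ℂ] B) w - T)) :
    IsUnit (algebraMap ℂ (B →L[ℂ] B) z - T) := by
  rcases subsingleton_or_nontrivial B with hB | hB
  · exact ContinuousLinearMap.isUnit_iff_bijective.2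
      ⟨Function.injective_of_subsingleton _, fun y => ⟨0, Subsingleton.elim _ _⟩⟩
  have hev : ∀ᶠ w in 𝓝 z, ‖w - z‖ < c / 4 := by
    have : Tendsto (fun w : ℂ => ‖w - z‖) (𝓝 z) (𝓝 0) := by
      have : Continuous (fun w : ℂ => ‖w - z‖) := by fun_prop
      simpa using this.tendsto z
    exact this.eventually_lt_const (by positivity)
  obtain ⟨w, ⟨u, hu⟩, hw⟩ := (hz.and_eventually hev).exists
  have hdiff : (algebraMap ℂ (B →L[ℂ] B) z - T) - u = algebraMap ℂ (B →L[ℂ] B) (z - w) := by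
    rw [hu, map_sub]; abel
  have hub : ∀ x, c / 2 * ‖x‖ ≤ ‖(u : B →L[ℂ] B) x‖ := by
    intro x
    have h1 := hb x
    have h2 : (algebraMap ℂ (B →L[ℂ] B) z - T) x
        = (u : B →L[ℂ] B) x + (z - w) • x := by
      have := congrArg (fun S : B →L[ℂ] B => S x) hdiff
      simp only [sub_apply, Algebra.algebraMap_eq_smul_one, smul_apply,
        one_apply_eq_self] at this ⊢
      rw [← this]; abel
    rw [h2] at h1
    have h3 : ‖(z - w) • x‖ ≤ c / 4 * ‖x‖ := by
      rw [norm_smul, norm_sub_rev]; gcongr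
    have := norm_add_le ((u : B →L[ℂ] B) x) ((z - w) • x)
    nlinarith [norm_nonneg x]
  -- The lower bound passes to the nearby invertible operator and controls its inverse. Then `z - T`
  -- lies within `c/4` of an operator whose inverse has norm at most `2/c`, so a Neumann series
  -- applies.
  have hinv : ‖((u⁻¹ : (B →L[ℂ] B)ˣ) : B →L[ℂ] B)‖ ≤ 2 / c := by
    refine ContinuousLinearMap.opNorm_le_bound _ (by positivity) fun y => ?_
    have h1 := hub ((u⁻¹ : (B →L[ℂ] B)ˣ).1 y)
    have h2 : (u : B →L[ℂ] B) ((u⁻¹ : (B →L[ℂ] B)ˣ).1 y) = y := by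
      exact congrArg (fun S : B →L[ℂ] B => S y) u.mul_inv
    rw [h2] at h1
    rw [div_mul_eq_mul_div, le_div_iff₀ hc]
    linarith
  have hpos : 0 < ‖((u⁻¹ : (B →L[ℂ] B)ˣ) : B →L[ℂ] B)‖ := norm_pos_iff.2 (u⁻¹).ne_zero
  have hlt : ‖(algebraMap ℂ (B →L[ℂ] B) z - T) - u‖ <
      ‖((u⁻¹ : (B →L[ℂ] B)ˣ) : B →L[ℂ] B)‖⁻¹ := by
    rw [hdiff, norm_algebraMap', norm_sub_rev]
    refine hw.trans (lt_of_lt_of_le ?_ ((inv_le_inv₀ (by positivity) hpos).2 hinv))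
    rw [inv_div]; linarith
  exact (Units.ofNearby u _ hlt).isUnit

/-- Otherwise the ray from `w` to infinity has a last spectral point `z`. There `z - T` is Fredholm
and injective, hence bounded below, and it is a limit of invertible operators from further out on
the ray; so it is invertible, a contradiction. -/
theorem isUnit_sub_of_isFredholm_of_not_eigenvalue {T : B →L[ℂ] B}
    (hess : essentialSpectrum T ⊆ Metric.ball 0 1)
    (hev : ∀ z : ℂ, Module.End.HasEigenvalue (T : B →ₗ[ℂ] B) z → z ≠ 1 → ‖z‖ < 1)
    {w : ℂ} (hw : 1 ≤ ‖w‖) (hw1 : w ≠ 1) : IsUnit (algebraMap ℂ (B →L[ℂ] B) w - T) := by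
  by_contra hcon
  have hcomp : IsCompact (spectrum ℂ T) := spectrum.isCompact T
  set S : Set ℝ := {s | 1 ≤ s ∧ (s : ℂ) * w ∈ spectrum ℂ T} with hS
  have hSc : IsClosed S := by
    apply IsClosed.inter isClosed_Ici
    exact hcomp.isClosed.preimage (by fun_prop : Continuous fun s : ℝ => (s : ℂ) * w)
  have hSb : BddAbove S := by
    obtain ⟨M, hM⟩ := hcomp.isBounded.exists_norm_le
    refine ⟨M, fun s hs => ?_⟩
    have h1 := hM _ hs.2
    rw [norm_mul, Complex.norm_real, Real.norm_eq_abs, abs_of_nonneg (by linarith [hs.1])] at h1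
    nlinarith [hs.1]
  have hSne : S.Nonempty := ⟨1, le_rfl, by simpa [spectrum.mem_iff] using hcon⟩
  have hmem := hSc.csSup_mem hSne hSb
  set s₀ := sSup S
  have hz1 : 1 ≤ ‖(s₀ : ℂ) * w‖ := by
    rw [norm_mul, Complex.norm_real, Real.norm_eq_abs, abs_of_nonneg (by linarith [hmem.1])]
    nlinarith [hmem.1]
  -- The ray can meet `1` only at its starting point, because `‖w‖ ≥ 1` and `s₀ ≥ 1`.
  have hzne : (s₀ : ℂ) * w ≠ 1 := by
    intro h
    have hs0 : (0 : ℝ) < s₀ := by linarith [hmem.1]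
    have h1 : ‖(s₀ : ℂ) * w‖ = 1 := by rw [h]; simp
    rw [norm_mul, Complex.norm_real, Real.norm_eq_abs, abs_of_nonneg hs0.le] at h1
    have h2 : s₀ = 1 := by nlinarith [hmem.1]
    rw [h2] at h
    exact hw1 (by simpa using h)
  set z := (s₀ : ℂ) * w with hzdef
  have hfred : (z • ContinuousLinearMap.id ℂ B - T).IsFredholm := by
    by_contra hnf
    have : z ∈ Metric.ball (0 : ℂ) 1 := hess hnf
    simp at this; linarith
  have hal : algebraMap ℂ (B →L[ℂ] B) z - T = z • ContinuousLinearMap.id ℂ B - T := by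
    rw [Algebra.algebraMap_eq_smul_one]; rfl
  have hinj : Function.Injective (z • ContinuousLinearMap.id ℂ B - T) := by
    rw [injective_iff_map_eq_zero]
    intro x hx
    by_contra hx0
    have : Module.End.HasEigenvalue (T : B →ₗ[ℂ] B) z := by
      refine Module.End.hasEigenvalue_of_hasEigenvector (x := x) ⟨?_, hx0⟩
      rw [Module.End.mem_eigenspace_iff]
      simp [sub_eq_zero] at hx
      exact hx.symm
    linarith [hev z this hzne]
  obtain ⟨K, hK⟩ := ContinuousLinearMap.antilipschitz_of_injective_of_isClosed_range _ hinj
    hfred.isClosed_range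
  have hb : ∀ x, ((K : ℝ) + 1)⁻¹ * ‖x‖ ≤ ‖(algebraMap ℂ (B →L[ℂ] B) z - T) x‖ := by
    intro x
    have h := hK.le_mul_dist x 0
    rw [hal]
    simp only [map_zero, dist_zero_right] at h
    rw [inv_mul_le_iff₀ (by positivity)]
    nlinarith [norm_nonneg ((z • ContinuousLinearMap.id ℂ B - T) x)]
  refine hmem.2 ?_
  refine isUnit_of_boundedBelow_of_frequently (c := ((K : ℝ) + 1)⁻¹) (by positivity) hb ?_
  have htend : Tendsto (fun s : ℝ => (s : ℂ) * w) (𝓝[>] s₀) (𝓝 z) := by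
    have : Continuous (fun s : ℝ => (s : ℂ) * w) := by fun_prop
    exact (this.tendsto s₀).mono_left nhdsWithin_le_nhds
  refine htend.frequently (Eventually.frequently ?_)
  filter_upwards [self_mem_nhdsWithin] with s hs
  by_contra hns
  have : s ∈ S := ⟨hmem.1.trans (le_of_lt hs), hns⟩
  exact absurd (le_csSup hSb this) (not_le.2 hs)

end Spectral

/-! ### Right and left eigenvectors at the simple eigenvalue -/

section SimpleEigenvalue

variable {B : Type*} [NormedAddCommGroup B] [NormedSpace ℂ B]

/-- The one-dimensional generalized eigenspace is stable under the nilpotent map `T - z`, which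
therefore acts on it by the scalar `0`: its generator is a true eigenvector. -/
theorem IsSimpleEigenvalue.exists_eigenvector {T : B →L[ℂ] B} {z : ℂ}
    (h : IsSimpleEigenvalue T z) :
    ∃ e : B, e ≠ 0 ∧ T e = z • e ∧
      ∀ x, (∃ k : ℕ, (((T : B →ₗ[ℂ] B) - z • 1) ^ k) x = 0) → ∃ a : ℂ, x = a • e := by
  obtain ⟨⟨e, he⟩, he0, hspan⟩ := finrank_eq_one_iff'.1 h
  have he0' : e ≠ 0 := fun h => he0 (by simpa using h)
  have hmem : ∀ x, (∃ k : ℕ, (((T : B →ₗ[ℂ] B) - z • 1) ^ k) x = 0) → ∃ a : ℂ, x = a • e := by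
    intro x hx
    obtain ⟨a, ha⟩ := hspan ⟨x, (Module.End.mem_maxGenEigenspace _ _ _).2 hx⟩
    exact ⟨a, by simpa using (congrArg Subtype.val ha).symm⟩
  refine ⟨e, he0', ?_, hmem⟩
  obtain ⟨k, hk⟩ := (Module.End.mem_maxGenEigenspace _ _ _).1 he
  set N := (T : B →ₗ[ℂ] B) - z • 1 with hN
  obtain ⟨a, ha⟩ := hmem (N e) ⟨k, by
    rw [← Module.End.mul_apply, ← pow_succ, pow_succ', Module.End.mul_apply, hk, map_zero]⟩
  have hpow : ∀ j : ℕ, (N ^ j) e = a ^ j • e := by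
    intro j
    induction j with
    | zero => simp
    | succ j ih => rw [pow_succ, Module.End.mul_apply, ha, map_smul, ih, smul_smul, pow_succ']
  rw [hpow k] at hk
  have ha0 : a = 0 := by
    rcases smul_eq_zero.1 hk with h | h
    · exact eq_zero_of_pow_eq_zero h
    · exact absurd h he0'
  rw [ha0, zero_smul] at ha
  have : T e - z • e = 0 := by simpa [hN] using ha
  exact sub_eq_zero.1 this

variable [CompleteSpace B]

/-- A limit of invertible operators that is Fredholm has `dim coker ≤ dim ker`: if its kernel is
spanned by `e`, and `e` is not in the range, then `e` and the range span the space. -/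
theorem exists_range_add_smul_of_frequently_isUnit {T : B →L[ℂ] B} (hT : T.IsFredholm)
    (hfreq : ∃ᶠ S in 𝓝 T, IsUnit S) {e : B} (hker : ∀ x, T x = 0 → ∃ a : ℂ, x = a • e)
    (he : ∀ x, T x ≠ e) (y : B) : ∃ (x : B) (a : ℂ), y = T x + a • e := by
  obtain ⟨pkg⟩ := hT.nonempty_fredholmPackage
  have hMK := pkg.decDom.isTopCompl
  have hRC := pkg.decCodom.isTopCompl
  have hcl : IsClosed (pkg.decDom.X₁ : Set B) := hMK.isClosed
  have hcl2 : IsClosed (pkg.decCodom.X₀ : Set B) := hRC.symm.isClosed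
  have : CompleteSpace pkg.decDom.X₁ := hcl.completeSpace_coe
  have : CompleteSpace pkg.decCodom.X₀ := hcl2.completeSpace_coe
  -- On a complement of the kernel, `T` is an isomorphism onto its range; adding the inclusion of a
  -- complement of the range gives an isomorphism onto `B`. Invertibility is an open condition, so
  -- the same construction `Ψ S` stays invertible for `S` near `T`.
  let Φ : (pkg.decDom.X₁ × pkg.decCodom.X₀) ≃L[ℂ] B :=
    (pkg.equiv.prodCongr (.refl ℂ _)).trans (Submodule.prodEquivOfIsTopCompl _ _ hRC)
  let Ψ : (B →L[ℂ] B) → (pkg.decDom.X₁ × pkg.decCodom.X₀ →L[ℂ] B) := fun S =>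
    (S ∘L pkg.decDom.X₁.subtypeL).coprod pkg.decCodom.X₀.subtypeL
  have hΨ : Continuous Ψ := by
    have : Ψ = fun S => (S ∘L pkg.decDom.X₁.subtypeL) ∘L ContinuousLinearMap.fst ℂ _ _ +
        pkg.decCodom.X₀.subtypeL ∘L ContinuousLinearMap.snd ℂ _ _ := by
      ext S x <;> simp [Ψ]
    rw [this]
    fun_prop
  have hΦ : (Φ : _ →L[ℂ] B) = Ψ T := by
    have hT : ∀ x : pkg.decDom.X₁, T x = pkg.equiv x := fun x => by
      have := congrArg (fun S : B →L[ℂ] B => S x) pkg.eq_equiv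
      simpa using this
    ext x <;> simp [Φ, Ψ, hT]
  have hnear : ∀ᶠ S in 𝓝 T, Ψ S ∈ Set.range
      (ContinuousLinearEquiv.toContinuousLinearMap :
        ((pkg.decDom.X₁ × pkg.decCodom.X₀) ≃L[ℂ] B) → _) := by
    refine hΨ.continuousAt.eventually_mem ?_
    rw [← hΦ]
    exact ContinuousLinearEquiv.nhds Φ
  obtain ⟨S, hS, Φ', hΦ'⟩ := (hfreq.and_eventually hnear).exists
  have hinj : Function.Injective (Ψ S) := by
    rw [← hΦ']; exact Φ'.injective
  obtain ⟨hSi, hSs⟩ := ContinuousLinearMap.isUnit_iff_bijective.1 hS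
  have hK : ∀ w ∈ pkg.decDom.X₀, ∃ a : ℂ, w = a • e := fun w hw => by
    rw [← pkg.ker_eq] at hw; exact hker w hw
  have hR : ∀ w ∈ pkg.decCodom.X₁, ∃ x, T x = w := fun w hw => by
    rw [← pkg.range_eq] at hw; exact hw
  -- every `c` in the complement of the range is `S (m + a • e)`, and `a = 0` forces `c = 0`
  have hC : ∀ c ∈ pkg.decCodom.X₀, ∃ m ∈ pkg.decDom.X₁, ∃ a : ℂ, S (m + a • e) = c := by
    intro c _
    obtain ⟨x, rfl⟩ := hSs c
    obtain ⟨m, k, hm, hk, rfl⟩ := Submodule.codisjoint_iff_exists_add_eq.1 hMK.isCompl.codisjoint x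
    obtain ⟨a, rfl⟩ := hK k hk
    exact ⟨m, hm, a, rfl⟩
  -- For an invertible `S` near `T`, a vector `c` of the cokernel complement is determined by the
  -- `e`-coordinate of its preimage. So this complement has dimension at most one, and it is spanned
  -- by the nonzero component `c₀` of `e`.
  have hC0 : ∀ c ∈ pkg.decCodom.X₀, ∀ m ∈ pkg.decDom.X₁, S m = c → c = 0 := by
    intro c hc m hm h
    have h1 : Ψ S (⟨m, hm⟩, -⟨c, hc⟩) = Ψ S 0 := by simp [Ψ, h]
    have h2 := hinj h1
    simpa using congrArg (fun p => (p.2 : B)) h2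
  have hdec : ∀ w : B, ∃ x, ∃ c ∈ pkg.decCodom.X₀, w = T x + c := by
    intro w
    obtain ⟨r, c, hr, hc, rfl⟩ :=
      Submodule.codisjoint_iff_exists_add_eq.1 hRC.isCompl.codisjoint w
    obtain ⟨x, rfl⟩ := hR r hr
    exact ⟨x, c, hc, rfl⟩
  obtain ⟨x₀, c₀, hc₀, he₀⟩ := hdec e
  obtain ⟨x, c, hc, hy⟩ := hdec y
  obtain ⟨m₀, hm₀, a₀, h₀⟩ := hC c₀ hc₀
  obtain ⟨m, hm, a, h⟩ := hC c hc
  have hc₀0 : c₀ ≠ 0 := fun h => he x₀ (by rw [he₀, h, add_zero])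
  have ha₀ : a₀ ≠ 0 := by
    rintro rfl
    exact hc₀0 (hC0 c₀ hc₀ m₀ hm₀ (by simpa using h₀))
  have hcc : a₀ • c - a • c₀ = 0 := by
    refine hC0 _ (sub_mem (Submodule.smul_mem _ _ hc) (Submodule.smul_mem _ _ hc₀))
      (a₀ • m - a • m₀) (sub_mem (Submodule.smul_mem _ _ hm) (Submodule.smul_mem _ _ hm₀)) ?_
    rw [← h, ← h₀, ← map_smul, ← map_smul, ← map_sub]
    congr 1
    module
  have hc' : c = (a / a₀) • c₀ := by
    rw [sub_eq_zero] at hcc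
    rw [div_eq_inv_mul, mul_smul, ← hcc, inv_smul_smul₀ ha₀]
  have hc₀' : c₀ = e - T x₀ := by rw [he₀]; abel
  refine ⟨x - (a / a₀) • x₀, a / a₀, ?_⟩
  rw [hy, hc', hc₀', map_sub, map_smul, smul_sub]
  abel

/-- The eigenvector, the left eigenvector and the decomposition of `B` at an isolated simple
eigenvalue that is the only point of the spectrum outside the open unit disk. -/
theorem exists_left_right_eigenvector {T : B →L[ℂ] B}
    (hess : essentialSpectrum T ⊆ Metric.ball 0 1)
    (hev : ∀ z : ℂ, Module.End.HasEigenvalue (T : B →ₗ[ℂ] B) z → z ≠ 1 → ‖z‖ < 1)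
    (hsimple : IsSimpleEigenvalue T 1) :
    ∃ (e : B) (φ : B →L[ℂ] ℂ), T e = e ∧ φ ∘L T = φ ∧ φ e = 1 ∧
      IsUnit (1 - T + φ.smulRight e) := by
  obtain ⟨e, he0, hTe, hgen⟩ := hsimple.exists_eigenvector
  rw [one_smul] at hTe
  have hfred : (1 - T).IsFredholm := by
    by_contra hnf
    have : (1 : ℂ) ∈ Metric.ball (0 : ℂ) 1 := hess (by
      simpa [essentialSpectrum, ContinuousLinearMap.one_def] using hnf)
    simp at this
  have hker : ∀ x, (1 - T) x = 0 → ∃ a : ℂ, x = a • e := by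
    intro x hx
    refine hgen x ⟨1, ?_⟩
    have : x - T x = 0 := by simpa using hx
    simp only [pow_one, one_smul, LinearMap.sub_apply, ContinuousLinearMap.coe_coe,
      Module.End.one_apply]
    rw [← sub_eq_zero.1 this, sub_self]
  have hker2 : ∀ x, (1 - T) ((1 - T) x) = 0 → ∃ a : ℂ, x = a • e := by
    intro x hx
    refine hgen x ⟨2, ?_⟩
    simp [pow_two] at hx ⊢
    rw [← hx]; abel
  -- Algebraic simplicity enters here: a preimage of `e` would be a generalized eigenvector of order
  -- two, hence a multiple of `e`, and would be mapped to `0`.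
  have hrange : ∀ x, (1 - T) x ≠ e := by
    intro x hx
    obtain ⟨a, rfl⟩ := hker2 x (by rw [hx]; simp [hTe])
    apply he0
    rw [← hx]; simp [hTe]
  have hfreq : ∃ᶠ S in 𝓝 (1 - T), IsUnit S := by
    have htend : Tendsto (fun s : ℝ => algebraMap ℂ (B →L[ℂ] B) (s : ℂ) - T) (𝓝[>] 1)
        (𝓝 (1 - T)) := by
      have : Continuous (fun s : ℝ => algebraMap ℂ (B →L[ℂ] B) (s : ℂ) - T) := by
        have := (algebraMapCLM ℂ (B →L[ℂ] B)).continuous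
        exact (this.comp Complex.continuous_ofReal).sub continuous_const
      simpa using (this.tendsto 1).mono_left nhdsWithin_le_nhds
    refine htend.frequently (Eventually.frequently ?_)
    filter_upwards [self_mem_nhdsWithin] with s hs
    have hs' : (1 : ℝ) < s := hs
    refine isUnit_sub_of_isFredholm_of_not_eigenvalue hess hev ?_ ?_
    · rw [Complex.norm_real, Real.norm_eq_abs, abs_of_pos (by linarith)]; exact hs'.le
    · intro h
      have : s = 1 := by exact_mod_cast h
      linarith
  have hspan := exists_range_add_smul_of_frequently_isUnit hfred hfreq hker hrange
  -- a functional vanishing on the range of `1 - T`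
  obtain ⟨f, hfe, hfR⟩ : ∃ f : B →L[ℂ] ℂ, f e ≠ 0 ∧ ∀ x, f ((1 - T) x) = 0 := by
    have : IsClosed ((1 - T).range : Set B) := hfred.isClosed_range
    have hne : (1 - T).range.mkQL e ≠ 0 := by
      intro h
      obtain ⟨x, hx⟩ := (Submodule.Quotient.mk_eq_zero _).1 h
      exact hrange x hx
    obtain ⟨g, hg⟩ := SeparatingDual.exists_ne_zero (R := ℂ) hne
    refine ⟨g ∘L (1 - T).range.mkQL, hg, fun x => ?_⟩
    have : (1 - T).range.mkQL ((1 - T) x) = 0 :=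
      (Submodule.Quotient.mk_eq_zero _).2 ⟨x, rfl⟩
    rw [ContinuousLinearMap.comp_apply, this, map_zero]
  refine ⟨e, (f e)⁻¹ • f, hTe, ?_, by simp [hfe], ?_⟩
  · ext x
    have := hfR x
    simp [sub_eq_zero] at this
    simp [this]
  · rw [ContinuousLinearMap.isUnit_iff_bijective]
    constructor
    · rw [injective_iff_map_eq_zero]
      intro x hx
      have hfx : f x = 0 := by
        have h1 := congrArg f hx
        have h2 := hfR x
        simp only [add_apply, map_add, h2, ContinuousLinearMap.smulRight_apply, map_smul, map_zero,
          smul_apply, smul_eq_mul, zero_add] at h1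
        field_simp at h1
        exact h1
      have hx' : (1 - T) x = 0 := by simpa [hfx] using hx
      obtain ⟨a, rfl⟩ := hker x hx'
      have : a = 0 := by simpa [hfe] using hfx
      simp [this]
    · intro y
      obtain ⟨x, a, rfl⟩ := hspan y
      -- Adding a multiple of `e` does not change the image under `1 - T`, so the value of the
      -- functional can be adjusted to `a`.
      refine ⟨x + (a - (f e)⁻¹ * f x) • e, ?_⟩
      have hTe' : (1 - T) e = 0 := by simp [hTe]
      have h1 : (1 - T) (x + (a - (f e)⁻¹ * f x) • e) = (1 - T) x := by
        rw [map_add, map_smul, hTe', smul_zero, add_zero]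
      have h3 : (f e)⁻¹ * f (x + (a - (f e)⁻¹ * f x) • e) = a := by
        rw [map_add, map_smul, smul_eq_mul]; field_simp; ring
      rw [add_apply, h1, ContinuousLinearMap.smulRight_apply, smul_apply, smul_eq_mul, h3]

end SimpleEigenvalue

/-! ### Uniform geometric bounds for powers -/

section PowerBounds

/-- Division of `m` by `n` with remainder: one contracting power controls all powers, with a
constant depending only on `M`, `n` and `ρ`. That uniformity is what survives perturbation. -/
theorem norm_pow_le_of_norm_pow_le {A : Type*} [NormedRing A] [NormOneClass A] {a : A} {n : ℕ} (hn : 0 < n) {ρ M : ℝ}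
    (hρ : 0 < ρ) (hρ1 : ρ < 1) (hM : 1 ≤ M) (h1 : ‖a ^ n‖ ≤ ρ ^ n) (h2 : ‖a‖ ≤ M) (m : ℕ) :
    ‖a ^ m‖ ≤ M ^ n / ρ ^ n * ρ ^ m := by
  have h3 : ‖a ^ m‖ ≤ (ρ ^ n) ^ (m / n) * M ^ (m % n) := by
    conv_lhs => rw [← Nat.div_add_mod m n, pow_add, pow_mul]
    refine (norm_mul_le _ _).trans ?_
    gcongr
    · exact (norm_pow_le _ _).trans (by gcongr)
    · exact (norm_pow_le _ _).trans (by gcongr)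
  have h4 : M ^ (m % n) ≤ M ^ n := pow_le_pow_right₀ hM (Nat.mod_lt m hn).le
  have h5 : (ρ ^ n) ^ (m / n) * ρ ^ n ≤ ρ ^ m := by
    rw [← pow_mul, ← pow_add]
    refine pow_le_pow_of_le_one hρ.le hρ1.le ?_
    have := Nat.div_add_mod m n
    have := Nat.mod_lt m hn
    omega
  calc ‖a ^ m‖ ≤ (ρ ^ n) ^ (m / n) * M ^ (m % n) := h3
    _ ≤ (ρ ^ n) ^ (m / n) * M ^ n := by gcongr
    _ = M ^ n / ρ ^ n * ((ρ ^ n) ^ (m / n) * ρ ^ n) := by field_simp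
    _ ≤ M ^ n / ρ ^ n * ρ ^ m := by gcongr

theorem pow_sub_pow_eq_sum {A : Type*} [Ring A] (a b : A) (n : ℕ) :
    a ^ n - b ^ n = ∑ i ∈ Finset.range n, a ^ i * (a - b) * b ^ (n - 1 - i) := by
  induction n with
  | zero => simp
  | succ n ih =>
    rw [Finset.sum_range_succ']
    have : ∑ i ∈ Finset.range n, a ^ (i + 1) * (a - b) * b ^ (n + 1 - 1 - (i + 1))
        = a * (a ^ n - b ^ n) := by
      rw [ih, Finset.mul_sum]
      refine Finset.sum_congr rfl fun i _ => ?_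
      rw [pow_succ', mul_assoc, mul_assoc, mul_assoc]
      congr 4
      omega
    rw [this, pow_succ', pow_succ']
    simp only [pow_zero, one_mul, Nat.add_sub_cancel, Nat.sub_zero]
    noncomm_ring

/-- Noncommutative telescoping. It gains the factor `‖a - b‖` at the cost of a factor `n`; it serves
both for the remainder operators and for comparing scalar `N`-th powers. -/
theorem norm_pow_sub_pow_le {A : Type*} [NormedRing A] {a b : A} {C ρ : ℝ} (hC : 0 < C) (hρ : 0 < ρ)
    (ha : ∀ m : ℕ, ‖a ^ m‖ ≤ C * ρ ^ m) (hb : ∀ m : ℕ, ‖b ^ m‖ ≤ C * ρ ^ m) (n : ℕ) :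
    ‖a ^ n - b ^ n‖ ≤ C ^ 2 / ρ * (n * ρ ^ n) * ‖a - b‖ := by
  rw [pow_sub_pow_eq_sum]
  refine (norm_sum_le _ _).trans ?_
  have : ∀ i ∈ Finset.range n, ‖a ^ i * (a - b) * b ^ (n - 1 - i)‖
      ≤ C ^ 2 / ρ * ρ ^ n * ‖a - b‖ := by
    intro i hi
    have hi' := Finset.mem_range.1 hi
    calc ‖a ^ i * (a - b) * b ^ (n - 1 - i)‖ ≤ ‖a ^ i‖ * ‖a - b‖ * ‖b ^ (n - 1 - i)‖ :=
          (norm_mul_le _ _).trans (by gcongr; exact norm_mul_le _ _)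
      _ ≤ (C * ρ ^ i) * ‖a - b‖ * (C * ρ ^ (n - 1 - i)) := by
          gcongr
          · exact ha i
          · exact hb _
      _ = C ^ 2 / ρ * (ρ ^ i * ρ ^ (n - 1 - i) * ρ) * ‖a - b‖ := by field_simp
      _ = _ := by
          rw [← pow_add, ← pow_succ]; congr 4; omega
  refine (Finset.sum_le_sum this).trans (le_of_eq ?_)
  simp; ring

variable {A : Type*} [NormedRing A] [NormedAlgebra ℂ A] [CompleteSpace A]

/-- Gelfand's formula for a spectral radius below one. -/
theorem exists_norm_pow_lt_one [NormOneClass A] {a : A}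
    (h : spectrum ℂ a ⊆ Metric.ball 0 1) : ∃ n : ℕ, 0 < n ∧ ‖a ^ n‖ < 1 := by
  have : Nontrivial A := NormOneClass.nontrivial
  have hr : spectralRadius ℂ a < (1 : ℝ≥0) :=
    spectrum.spectralRadius_lt_of_forall_lt a fun z hz => by
      have := h hz
      rw [mem_ball_zero_iff] at this
      exact_mod_cast this
  have h1 := (spectrum.pow_nnnorm_pow_one_div_tendsto_nhds_spectralRadius a).eventually_lt_const hr
  obtain ⟨n, hn, hn0⟩ := (h1.and (eventually_gt_atTop 0)).exists
  refine ⟨n, hn0, ?_⟩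
  by_contra hcon
  push Not at hcon
  have h2 : (1 : ENNReal) ≤ (‖a ^ n‖₊ : ENNReal) := by exact_mod_cast hcon
  have h3 : (1 : ENNReal) ≤ (‖a ^ n‖₊ : ENNReal) ^ (1 / (n : ℝ)) := by
    calc (1 : ENNReal) = 1 ^ (1 / (n : ℝ)) := by simp
      _ ≤ _ := ENNReal.rpow_le_rpow h2 (by positivity)
  exact absurd hn (not_lt.2 (by simpa using h3))

/-- Only one power has to be contracting, and the norm of one fixed power is continuous in the
parameter. The rate `ρ` is the `n`-th root of a number strictly between that norm and one. -/
theorem eventually_norm_pow_le [NormOneClass A] {X : Type*} [TopologicalSpace X] {f : X → A}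
    {x₀ : X} (hf : ContinuousAt f x₀) (h : spectrum ℂ (f x₀) ⊆ Metric.ball 0 1) :
    ∃ C ρ : ℝ, 0 < C ∧ 0 < ρ ∧ ρ < 1 ∧ ∀ᶠ x in 𝓝 x₀, ∀ m : ℕ, ‖f x ^ m‖ ≤ C * ρ ^ m := by
  obtain ⟨n, hn, hlt⟩ := exists_norm_pow_lt_one h
  obtain ⟨q, hq, hq1⟩ := exists_between hlt
  have hq0 : 0 < q := (norm_nonneg _).trans_lt hq
  set ρ := q ^ (1 / (n : ℝ)) with hρ
  have hρ0 : 0 < ρ := by positivity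
  have hρ1 : ρ < 1 := Real.rpow_lt_one hq0.le hq1 (by positivity)
  have hρn : ρ ^ n = q := by
    rw [hρ, ← Real.rpow_natCast, ← Real.rpow_mul hq0.le]
    rw [one_div, inv_mul_cancel₀ (by positivity), Real.rpow_one]
  refine ⟨(‖f x₀‖ + 1) ^ n / ρ ^ n, ρ, by positivity, hρ0, hρ1, ?_⟩
  have e1 : ∀ᶠ x in 𝓝 x₀, ‖f x ^ n‖ < q := (hf.pow n).norm.eventually_lt_const hq
  have e2 : ∀ᶠ x in 𝓝 x₀, ‖f x‖ < ‖f x₀‖ + 1 := hf.norm.eventually_lt_const (by linarith)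
  filter_upwards [e1, e2] with x h1 h2 m
  exact norm_pow_le_of_norm_pow_le hn hρ0 hρ1 (by linarith [norm_nonneg (f x₀)])
    (hρn ▸ h1.le) h2.le m

theorem exists_norm_pow_le_of_isCompact [NormOneClass A] {X : Type*} [TopologicalSpace X]
    {f : X → A} {s : Set X} (hs : IsCompact s) (hf : Continuous f)
    (h : ∀ x ∈ s, spectrum ℂ (f x) ⊆ Metric.ball 0 1) :
    ∃ C ρ : ℝ, 0 < C ∧ 0 < ρ ∧ ρ < 1 ∧ ∀ x ∈ s, ∀ m : ℕ, ‖f x ^ m‖ ≤ C * ρ ^ m := by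
  have key : ∃ C ρ : ℝ, 0 < C ∧ 0 < ρ ∧ ρ < 1 ∧ ∀ x ∈ s, ∀ m : ℕ, ‖f x ^ m‖ ≤ C * ρ ^ m := by
    refine hs.induction_on (p := fun s => ∃ C ρ : ℝ, 0 < C ∧ 0 < ρ ∧ ρ < 1 ∧
      ∀ x ∈ s, ∀ m : ℕ, ‖f x ^ m‖ ≤ C * ρ ^ m) ?_ ?_ ?_ ?_
    · exact ⟨1, 1 / 2, by norm_num, by norm_num, by norm_num, by simp⟩
    · rintro s t hst ⟨C, ρ, h1, h2, h3, h4⟩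
      exact ⟨C, ρ, h1, h2, h3, fun x hx => h4 x (hst hx)⟩
    · rintro s t ⟨C, ρ, h1, h2, h3, h4⟩ ⟨C', ρ', h1', h2', h3', h4'⟩
      refine ⟨max C C', max ρ ρ', lt_max_of_lt_left h1, lt_max_of_lt_left h2, max_lt h3 h3', ?_⟩
      rintro x (hx | hx) m
      · exact (h4 x hx m).trans (by gcongr <;> exact le_max_left _ _)
      · exact (h4' x hx m).trans (by gcongr <;> exact le_max_right _ _)
    · intro x hx
      obtain ⟨C, ρ, h1, h2, h3, h4⟩ := eventually_norm_pow_le hf.continuousAt (h x hx)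
      exact ⟨_, mem_nhdsWithin_of_mem_nhds h4, C, ρ, h1, h2, h3, fun y hy => hy⟩
  exact key

end PowerBounds

/-! ### Splitting off a spectral projection -/

section Projection

variable {B : Type*} [NormedAddCommGroup B] [NormedSpace ℂ B]

theorem smulRight_mul_mul_smulRight (φ : B →L[ℂ] ℂ) (e : B) (S : B →L[ℂ] B) :
    φ.smulRight e * S * φ.smulRight e = φ (S e) • φ.smulRight e := by
  ext x
  simp [smul_smul, mul_comm]

theorem pow_eq_of_isIdempotent {A : Type*} [Ring A] [Algebra ℂ A] {T p : A} {c : ℂ}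
    (h1 : T * p = c • p) (h2 : p * T = c • p) (hp : p * p = p) {n : ℕ} (hn : 1 ≤ n) :
    T ^ n = c ^ n • p + (T - c • p) ^ n := by
  induction n, hn using Nat.le_induction with
  | base => simp
  | succ n hn ih =>
    have h3 : (T - c • p) ^ n * p = 0 := by
      obtain ⟨m, rfl⟩ := Nat.exists_eq_add_of_le' hn
      rw [pow_succ, mul_assoc, sub_mul, h1, smul_mul_assoc, hp, sub_self, mul_zero]
    calc T ^ (n + 1) = (c ^ n • p + (T - c • p) ^ n) * T := by rw [pow_succ, ih]
      _ = c ^ n • (p * T) + (T - c • p) ^ n * (T - c • p) + c • ((T - c • p) ^ n * p) := by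
        rw [add_mul, smul_mul_assoc, mul_sub, mul_smul_comm]; abel
      _ = _ := by rw [h2, h3, smul_zero, add_zero, smul_smul, ← pow_succ, ← pow_succ]

theorem isUnit_one_add_smul {A : Type*} [Ring A] [Algebra ℂ A] {p : A} (hp : p * p = p) {a : ℂ}
    (ha : 1 + a ≠ 0) : IsUnit (1 + a • p) := by
  have key : ∀ a b : ℂ, a + b + a * b = 0 → (1 + a • p) * (1 + b • p) = 1 := by
    intro a b h
    have : (1 + a • p) * (1 + b • p) = 1 + (a + b + a * b) • p := by
      rw [mul_add, add_mul, add_mul, smul_mul_smul_comm, hp]; simp only [mul_one, one_mul]; module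
    rw [this, h, zero_smul, add_zero]
  have h : a + -a / (1 + a) + a * (-a / (1 + a)) = 0 := by field_simp; ring
  exact ⟨⟨1 + a • p, 1 + (-a / (1 + a)) • p, key _ _ h, key _ _ (by rw [← h]; ring)⟩, rfl⟩

/-- Subtracting the projection moves the eigenvalue `1` to `0`. For `z ≠ 1` this is the
factorization `z - (T - p) = (z - T)(1 + p/(z - 1))`; at `z = 1` it is the assumed invertibility. -/
theorem spectrum_sub_projection_subset {A : Type*} [Ring A] [Algebra ℂ A] {T p : A}
    (h1 : T * p = p) (hp : p * p = p) (hunit : IsUnit (1 - T + p))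
    (hT : ∀ z : ℂ, 1 ≤ ‖z‖ → z ≠ 1 → IsUnit (algebraMap ℂ A z - T)) :
    spectrum ℂ (T - p) ⊆ Metric.ball 0 1 := by
  intro z hz
  rw [mem_ball_zero_iff]
  by_contra hcon
  push Not at hcon
  refine hz ?_
  by_cases hz1 : z = 1
  · subst hz1
    change IsUnit (algebraMap ℂ A 1 - (T - p))
    rwa [map_one, ← sub_add]
  · have hz1' : z - 1 ≠ 0 := sub_ne_zero.2 hz1
    have hz0 : z ≠ 0 := by rintro rfl; simp at hcon; linarith
    have h3 : algebraMap ℂ A z - (T - p) = (algebraMap ℂ A z - T) * (1 + (z - 1)⁻¹ • p) := by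
      rw [mul_add, mul_one, mul_smul_comm, sub_mul, h1, Algebra.algebraMap_eq_smul_one,
        smul_mul_assoc, one_mul]
      have : z • p - p = (z - 1) • p := by module
      rw [this, inv_smul_smul₀ hz1']; abel
    change IsUnit (algebraMap ℂ A z - (T - p))
    rw [h3]
    refine (hT z hcon hz1).mul (isUnit_one_add_smul hp ?_)
    field_simp; simpa using ⟨hz0, hz1'⟩

end Projection

/-! ### Perturbation of the leading eigenvalue -/

section Perturbation

variable {B : Type*} [NormedAddCommGroup B] [NormedSpace ℂ B] [CompleteSpace B]

/-- Analytic perturbation theory of a simple isolated eigenvalue. With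
`K t z = z - L t + e ⊗ φ`, the eigenvalue near `1` is the solution of `φ ((K t z)⁻¹ e) = 1`. -/
theorem exists_contDiffAt_eigenvalue {L : ℝ → B →L[ℂ] B} {n : WithTop ℕ∞} (hn : n ≠ 0)
    (hL : ContDiffAt ℝ n L 0) {e : B} {φ : B →L[ℂ] ℂ} (he : L 0 e = e) (hφ : φ ∘L L 0 = φ)
    (hφe : φ e = 1) (hunit : IsUnit (1 - L 0 + φ.smulRight e)) :
    ∃ (lam : ℝ → ℂ) (p : ℝ → B →L[ℂ] B), ContDiffAt ℝ n lam 0 ∧ ContDiffAt ℝ n p 0 ∧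
      lam 0 = 1 ∧ p 0 = φ.smulRight e ∧ ∀ᶠ t in 𝓝 0,
        L t * p t = lam t • p t ∧ p t * L t = lam t • p t ∧ p t * p t = p t := by
  set p₀ := φ.smulRight e with hp₀
  set K : ℝ × ℂ → B →L[ℂ] B := fun x => algebraMap ℂ (B →L[ℂ] B) x.2 - L x.1 + p₀ with hK
  have hK01 : K (0, 1) = 1 - L 0 + p₀ := by simp [hK]
  have hKc : ContDiffAt ℝ n K (0, 1) := by
    have h1 : ContDiff ℝ n (fun z : ℂ => algebraMap ℂ (B →L[ℂ] B) z) :=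
      ((algebraMapCLM ℂ (B →L[ℂ] B)).restrictScalars ℝ).contDiff
    have h2 : ContDiffAt ℝ n (fun x : ℝ × ℂ => L x.1) (0, 1) :=
      ContDiffAt.comp (g := L) (f := Prod.fst) (x := ((0 : ℝ), (1 : ℂ))) hL contDiffAt_fst
    exact ((h1.comp contDiff_snd).contDiffAt.sub h2).add contDiffAt_const
  have hinv : ∀ x : ℝ × ℂ, IsUnit (K x) → ContDiffAt ℝ n K x →
      ContDiffAt ℝ n (fun y => Ring.inverse (K y)) x := by
    rintro x ⟨u, hu⟩ hx
    have := contDiffAt_ringInverse ℝ (n := n) u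
    rw [hu] at this
    exact this.comp x hx
  have hu01 : IsUnit (K (0, 1)) := hK01 ▸ hunit
  have hD : ContDiffAt ℝ n (fun x => φ (Ring.inverse (K x) e)) (0, 1) := by
    have h1 : ContDiff ℝ n (fun S : B →L[ℂ] B => φ (S e)) :=
      ((φ ∘L (ContinuousLinearMap.apply ℂ B e)).restrictScalars ℝ).contDiff
    exact h1.contDiffAt.comp _ (hinv _ hu01 hKc)
  have hevu : ∀ᶠ x in 𝓝 ((0 : ℝ), (1 : ℂ)), IsUnit (K x) :=
    hKc.continuousAt.eventually_mem (Units.isOpen.mem_nhds hu01)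
  have hap : ∀ {S T : B →L[ℂ] B}, S = T → ∀ x, S x = T x := fun h x => by rw [h]
  -- At `t = 0` the vector `e` is an eigenvector of `K (0, z)` with eigenvalue `z`, so the scalar
  -- function is exactly `1/z`. Its derivative at `z = 1` is `-1`, which makes the implicit function
  -- theorem applicable.
  have hD0 : ∀ᶠ z in 𝓝 (1 : ℂ), φ (Ring.inverse (K (0, z)) e) = z⁻¹ := by
    have h1 : ∀ᶠ z in 𝓝 (1 : ℂ), IsUnit (K (0, z)) :=
      (Continuous.prodMk_right (0 : ℝ)).tendsto (1 : ℂ) |>.eventually hevu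
    filter_upwards [h1, eventually_ne_nhds one_ne_zero] with z hz hz0
    have hKe : K (0, z) e = z • e := by
      simp [hK, hp₀, he, hφe, Algebra.algebraMap_eq_smul_one]
    have h2 := hap (Ring.inverse_mul_cancel _ hz) e
    have h3 : z • Ring.inverse (K (0, z)) e = e := by
      rw [← map_smul, ← hKe]; exact h2
    have h4 : Ring.inverse (K (0, z)) e = z⁻¹ • e := by
      rw [← h3, smul_smul, h3, inv_mul_cancel₀ hz0, one_smul]
    rw [h4, map_smul, hφe]; simp
  have hbase : φ (Ring.inverse (K (0, 1)) e) = 1 := by simpa using hD0.self_of_nhds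
  set D : ℝ × ℂ → ℂ := fun x => φ (Ring.inverse (K x) e) with hDdef
  have hder : fderiv ℝ D (0, 1) ∘L .inr ℝ ℝ ℂ = (ContinuousLinearEquiv.neg ℝ : ℂ ≃L[ℝ] ℂ) := by
    have h1 : HasFDerivAt (fun z : ℂ => D (0, z)) (fderiv ℝ D (0, 1) ∘L .inr ℝ ℝ ℂ) 1 := by
      have h2 := (hD.differentiableAt hn).hasFDerivAt
      exact HasFDerivAt.comp (g := D) (f := fun z : ℂ => ((0 : ℝ), z)) 1 h2
        (hasFDerivAt_prodMk_right _ _)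
    have h3 : HasFDerivAt (fun z : ℂ => z⁻¹)
        ((ContinuousLinearEquiv.neg ℝ : ℂ ≃L[ℝ] ℂ) : ℂ →L[ℝ] ℂ) 1 := by
      have := ((hasDerivAt_inv (one_ne_zero (α := ℂ))).hasFDerivAt).restrictScalars ℝ
      refine this.congr_fderiv (ContinuousLinearMap.ext fun z => ?_)
      simp
    exact (h1.congr_of_eventuallyEq (by
      filter_upwards [hD0] with z hz using hz.symm)).unique h3
  have hif : (fderiv ℝ D (0, 1) ∘L .inr ℝ ℝ ℂ).IsInvertible := ⟨_, hder.symm⟩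
  set lam := hD.implicitFunction hn hif with hlam
  have hlam0 : lam 0 = 1 := hD.implicitFunction_apply_self hn hif
  have hlamc : ContDiffAt ℝ n lam 0 := hD.contDiffAt_implicitFunction hn hif
  have hlamD : ∀ᶠ t in 𝓝 (0 : ℝ), D (t, lam t) = 1 := by
    have := hD.eventually_apply_implicitFunction hn hif
    simpa only [hbase, hDdef] using this
  have hpair : ContDiffAt ℝ n (fun t => (t, lam t)) 0 := contDiffAt_id.prodMk hlamc
  set R : ℝ → B →L[ℂ] B := fun t => Ring.inverse (K (t, lam t)) with hR
  have hRc : ContDiffAt ℝ n R 0 :=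
    ContDiffAt.comp (g := fun x => Ring.inverse (K x)) (0 : ℝ)
      (by rw [hlam0]; exact hinv _ hu01 hKc) hpair
  have hRu : ∀ᶠ t in 𝓝 (0 : ℝ), IsUnit (K (t, lam t)) := by
    have := hpair.continuousAt.tendsto
    rw [hlam0] at this
    exact this.eventually hevu
  set c : ℝ → ℂ := fun t => φ (R t (R t e)) with hc
  have hcc : ContDiffAt ℝ n c 0 := by
    have h1 : ContDiff ℝ n (fun S : B →L[ℂ] B => φ (S e)) :=
      ((φ ∘L (ContinuousLinearMap.apply ℂ B e)).restrictScalars ℝ).contDiff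
    exact h1.contDiffAt.comp (0 : ℝ) (hRc.mul hRc)
  have hKe : K (0, 1) e = e := by simp [hK, hp₀, he, hφe]
  have hRe : R 0 e = e := by
    have h2 := hap (Ring.inverse_mul_cancel _ hu01) e
    simp only [hR, hlam0]
    conv_lhs => rw [← hKe]
    exact h2
  have hc0 : c 0 = 1 := by simp [hc, hRe, hφe]
  have hcne : ∀ᶠ t in 𝓝 (0 : ℝ), c t ≠ 0 :=
    hcc.continuousAt.eventually_ne (by rw [hc0]; exact one_ne_zero)
  have hp₀K : p₀ * K (0, 1) = p₀ := by
    rw [hK01]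
    ext x
    have h1 : φ (L 0 x) = φ x := congrArg (fun S : B →L[ℂ] ℂ => S x) hφ
    simp [hp₀, h1, hφe]
  have hp₀R : p₀ * R 0 = p₀ := by
    simp only [hR, hlam0]
    conv_lhs => rw [← hp₀K, mul_assoc, Ring.mul_inverse_cancel _ hu01, mul_one]
  have hRp₀ : R 0 * p₀ = p₀ := by
    ext x
    simp [hp₀, hRe]
  -- `R t * p₀ * R t` has rank one: it pairs the perturbed eigenvector `R t e` with the perturbed
  -- left eigenvector `φ ∘ R t`. Division by `c t = φ (R t (R t e))` makes it idempotent.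
  refine ⟨lam, fun t => (c t)⁻¹ • (R t * p₀ * R t), hlamc, ?_, hlam0, ?_, ?_⟩
  · exact (hcc.inv (by rw [hc0]; exact one_ne_zero)).smul ((hRc.mul contDiffAt_const).mul hRc)
  · simp only [hc0, inv_one, one_smul]
    rw [mul_assoc, hp₀R, hRp₀]
  filter_upwards [hlamD, hRu, hcne] with t hDt hut hct
  -- This is the implicit equation `φ (R t e) = 1` in operator form; both eigenvector identities
  -- follow from it.
  have hpRp : p₀ * R t * p₀ = p₀ := by
    rw [hp₀, smulRight_mul_mul_smulRight]
    have : φ (R t e) = 1 := hDt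
    rw [this, one_smul]
  have hKt : algebraMap ℂ (B →L[ℂ] B) (lam t) - L t = K (t, lam t) - p₀ := by simp [hK]
  have hl : (algebraMap ℂ (B →L[ℂ] B) (lam t) - L t) * (R t * p₀) = 0 := by
    rw [hKt, sub_mul, ← mul_assoc, ← mul_assoc, hpRp, Ring.mul_inverse_cancel _ hut, one_mul,
      sub_self]
  have hr : p₀ * R t * (algebraMap ℂ (B →L[ℂ] B) (lam t) - L t) = 0 := by
    rw [hKt, mul_sub, hpRp, mul_assoc, Ring.inverse_mul_cancel _ hut, mul_one, sub_self]
  refine ⟨?_, ?_, ?_⟩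
  · rw [sub_mul, sub_eq_zero, ← Algebra.smul_def] at hl
    rw [mul_smul_comm, ← mul_assoc, ← hl, smul_mul_assoc, smul_comm]
  · rw [mul_sub, sub_eq_zero, ← Algebra.commutes, ← Algebra.smul_def] at hr
    rw [smul_mul_assoc, mul_assoc, mul_assoc, ← mul_assoc p₀, ← hr, mul_smul_comm, smul_comm,
      mul_assoc]
  · have h1 : R t * p₀ * R t * (R t * p₀ * R t) = c t • (R t * p₀ * R t) := by
      have : p₀ * (R t * R t) * p₀ = c t • p₀ := by
        rw [hp₀, smulRight_mul_mul_smulRight]; rfl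
      calc R t * p₀ * R t * (R t * p₀ * R t) = R t * (p₀ * (R t * R t) * p₀) * R t := by
            noncomm_ring
        _ = _ := by rw [this, mul_smul_comm, smul_mul_assoc]
    rw [smul_mul_smul_comm, h1, smul_smul]
    congr 1
    field_simp

end Perturbation

/-! ### Expansion of the coded characteristic functions -/

section ScalarExpansion

variable {B : Type*} [NormedAddCommGroup B] [NormedSpace ℂ B] [CompleteSpace B]

/-- Absorbs the factor `n` produced by telescoping into a slightly larger rate. -/
theorem exists_mul_pow_le {ρ : ℝ} (h0 : 0 < ρ) (h1 : ρ < 1) :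
    ∃ C ρ' : ℝ, 0 < C ∧ ρ < ρ' ∧ ρ' < 1 ∧ ∀ n : ℕ, n * ρ ^ n ≤ C * ρ' ^ n := by
  obtain ⟨ρ', h2, h3⟩ := exists_between h1
  have hpos : 0 < ρ' := h0.trans h2
  have hq : |ρ / ρ'| < 1 := by
    rw [abs_of_pos (by positivity), div_lt_one (by linarith)]; exact h2
  have := (tendsto_self_mul_const_pow_of_abs_lt_one hq).bddAbove_range
  obtain ⟨M, hM⟩ := this
  refine ⟨max M 1, ρ', by positivity, h2, h3, fun n => ?_⟩
  have h4 : n * (ρ / ρ') ^ n ≤ max M 1 := (hM ⟨n, rfl⟩).trans (le_max_left _ _)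
  rw [div_pow, ← mul_div_assoc, div_le_iff₀ (by positivity)] at h4
  exact h4

/-- The spectral decomposition of `ℓ (L t ^ N v)` near `t = 0`. -/
theorem exists_spectral_expansion {L : ℝ → B →L[ℂ] B} {s : ℕ} (hs : 3 ≤ s)
    (hA1 : AssumptionA1 L s) (hA2 : AssumptionA2 L) (v : B) (ℓ : B →L[ℂ] ℂ) :
    ∃ (lam g : ℝ → ℂ) (δ C ρ : ℝ), ContDiffAt ℝ 3 lam 0 ∧ ContDiffAt ℝ 3 g 0 ∧ lam 0 = 1 ∧
      0 < δ ∧ 0 < C ∧ 0 < ρ ∧ ρ < 1 ∧ ∀ N : ℕ, 1 ≤ N → ∀ t : ℝ, |t| ≤ δ →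
        ‖ℓ ((L t ^ N) v) - lam t ^ N * g t‖ ≤ C * ρ ^ N ∧
        ‖(ℓ ((L t ^ N) v) - lam t ^ N * g t) - (ℓ ((L 0 ^ N) v) - g 0)‖ ≤ C * |t| * ρ ^ N := by
  obtain ⟨e, φ, he, hφ, hφe, hunit⟩ := exists_left_right_eigenvector
    hA2.essentialSpectrum_subset hA2.norm_lt_one hA2.simple
  have : Nontrivial B := ⟨e, 0, fun h => by simp [h] at hφe⟩
  have hL : ContDiffAt ℝ 3 L 0 := by
    obtain ⟨δ, hδ, h⟩ := hA1.smooth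
    exact (h.contDiffAt (Icc_mem_nhds (by linarith) hδ)).of_le (by exact_mod_cast hs)
  obtain ⟨lam, p, hlam, hp, hlam0, hp0, hev⟩ :=
    exists_contDiffAt_eigenvalue (by norm_num) hL he hφ hφe hunit
  -- `Q` is the part complementary to the leading eigenvalue. The second estimate telescopes `Q t ^
  -- N - Q 0 ^ N` and uses `‖Q t - Q 0‖ = O(|t|)`; the resulting factor `|t|` cancels the
  -- singularity `1/t` in Esseen's inequality.
  set Q : ℝ → B →L[ℂ] B := fun t => L t - lam t • p t with hQ
  have hQc : ContDiffAt ℝ 3 Q 0 := hL.sub (hlam.smul hp)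
  have hspec : spectrum ℂ (Q 0) ⊆ Metric.ball 0 1 := by
    simp only [hQ, hlam0, one_smul, hp0]
    refine spectrum_sub_projection_subset ?_ ?_ hunit fun z hz hz1 =>
      isUnit_sub_of_isFredholm_of_not_eigenvalue hA2.essentialSpectrum_subset hA2.norm_lt_one hz hz1
    · ext x; simp [he]
    · ext x; simp [hφe]
  obtain ⟨C₁, ρ₁, hC₁, hρ₁, hρ₁1, hpow⟩ := eventually_norm_pow_le hQc.continuousAt hspec
  obtain ⟨M, hM⟩ := ((hQc.differentiableAt (by norm_num)).isBigO_sub).bound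
  obtain ⟨C₂, ρ₂, hC₂, hρ₂, hρ₂1, hnpow⟩ := exists_mul_pow_le hρ₁ hρ₁1
  obtain ⟨δ, hδ, hball⟩ := Metric.nhds_basis_closedBall.eventually_iff.1
    ((hev.and hpow).and hM)
  have hpow0 := hpow.self_of_nhds
  have hev0 := hev.self_of_nhds
  set D := ‖ℓ‖ * ‖v‖ with hD
  have hval : ∀ S : B →L[ℂ] B, ‖ℓ (S v)‖ ≤ D * ‖S‖ := fun S => by
    calc ‖ℓ (S v)‖ ≤ ‖ℓ‖ * ‖S v‖ := ℓ.le_opNorm _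
      _ ≤ ‖ℓ‖ * (‖S‖ * ‖v‖) := by gcongr; exact S.le_opNorm _
      _ = _ := by ring
  have hD0 : 0 ≤ D := by positivity
  have hM0 : 0 ≤ |M| := abs_nonneg _
  have hρ₂0 : 0 < ρ₂ := hρ₁.trans hρ₂
  set C := D * C₁ + D * (C₁ ^ 2 / ρ₁ * C₂ * |M|) + 1 with hC
  have hdec : ∀ N : ℕ, 1 ≤ N → ∀ t, L t * p t = lam t • p t ∧ p t * L t = lam t • p t ∧
      p t * p t = p t → ℓ ((L t ^ N) v) - lam t ^ N * ℓ (p t v) = ℓ ((Q t ^ N) v) := by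
    intro N hN t ⟨h1, h2, h3⟩
    rw [pow_eq_of_isIdempotent h1 h2 h3 hN]
    simp [hQ]
  refine ⟨lam, fun t => ℓ (p t v), δ, C, ρ₂, hlam, ?_, hlam0, hδ, by positivity,
    hρ₁.trans hρ₂, hρ₂1, fun N hN t ht => ?_⟩
  · have h1 : ContDiff ℝ 3 (fun S : B →L[ℂ] B => ℓ (S v)) :=
      ((ℓ ∘L (ContinuousLinearMap.apply ℂ B v)).restrictScalars ℝ).contDiff
    exact h1.contDiffAt.comp (0 : ℝ) hp
  · obtain ⟨⟨h1, h2⟩, h3⟩ := hball (x := t) (by simpa using ht)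
    have h4 := hdec N hN t h1
    have h5 := hdec N hN 0 hev0
    rw [hlam0, one_pow, one_mul] at h5
    rw [h4, h5]
    constructor
    · calc ‖ℓ ((Q t ^ N) v)‖ ≤ D * ‖Q t ^ N‖ := hval _
        _ ≤ D * (C₁ * ρ₁ ^ N) := by gcongr; exact h2 N
        _ ≤ D * C₁ * ρ₂ ^ N := by
          rw [mul_assoc D]
          have : ρ₁ ^ N ≤ ρ₂ ^ N := by gcongr
          gcongr
        _ ≤ C * ρ₂ ^ N := by
          gcongr ?_ * _
          have : 0 ≤ D * (C₁ ^ 2 / ρ₁ * C₂ * |M|) := by positivity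
          linarith
    · have h6 : ℓ ((Q t ^ N) v) - ℓ ((Q 0 ^ N) v) = ℓ ((Q t ^ N - Q 0 ^ N) v) := by simp
      rw [h6]
      have h7 : ‖Q t - Q 0‖ ≤ |M| * |t| := by
        refine h3.trans ?_
        rw [sub_zero, Real.norm_eq_abs]; gcongr; exact le_abs_self M
      calc ‖ℓ ((Q t ^ N - Q 0 ^ N) v)‖ ≤ D * ‖Q t ^ N - Q 0 ^ N‖ := hval _
        _ ≤ D * (C₁ ^ 2 / ρ₁ * (N * ρ₁ ^ N) * ‖Q t - Q 0‖) := by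
          gcongr; exact norm_pow_sub_pow_le hC₁ hρ₁ h2 hpow0 N
        _ ≤ D * (C₁ ^ 2 / ρ₁ * (C₂ * ρ₂ ^ N) * (|M| * |t|)) := by
          gcongr D * (C₁ ^ 2 / ρ₁ * ?_ * ?_)
          exact hnpow N
        _ = D * (C₁ ^ 2 / ρ₁ * C₂ * |M|) * |t| * ρ₂ ^ N := by ring
        _ ≤ C * |t| * ρ₂ ^ N := by
          have h9 : 0 ≤ D * C₁ := by positivity
          gcongr ?_ * _ * _
          linarith

/-- Exponential decay of `ℓ (L t ^ N v)` away from `t = 0`. -/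
theorem exists_exponential_decay [Nontrivial B] {L : ℝ → B →L[ℂ] B} (hL : Continuous L)
    (hA3 : AssumptionA3 L) (v : B) (ℓ : B →L[ℂ] ℂ) {δ T : ℝ} (hδ : 0 < δ) :
    ∃ C ρ : ℝ, 0 < C ∧ 0 < ρ ∧ ρ < 1 ∧ ∀ t : ℝ, δ ≤ |t| → |t| ≤ T → ∀ N : ℕ,
      ‖ℓ ((L t ^ N) v)‖ ≤ C * ρ ^ N := by
  have hs : IsCompact {t : ℝ | δ ≤ |t| ∧ |t| ≤ T} := by
    have h1 : {t : ℝ | δ ≤ |t| ∧ |t| ≤ T} = {t : ℝ | δ ≤ |t|} ∩ Metric.closedBall 0 T := by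
      ext t; simp
    rw [h1]
    exact (isCompact_closedBall _ _).inter_left (isClosed_le continuous_const continuous_abs)
  obtain ⟨C, ρ, hC, h1, h2, h3⟩ := exists_norm_pow_le_of_isCompact hs hL fun t ht =>
    hA3 t fun h => by rw [h] at ht; simp at ht; linarith [ht.1]
  refine ⟨(‖ℓ‖ * ‖v‖ + 1) * C, ρ, by positivity, h1, h2, fun t ht ht' N => ?_⟩
  calc ‖ℓ ((L t ^ N) v)‖ ≤ ‖ℓ‖ * ‖(L t ^ N) v‖ := ℓ.le_opNorm _
    _ ≤ ‖ℓ‖ * (‖L t ^ N‖ * ‖v‖) := by gcongr; exact (L t ^ N).le_opNorm _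
    _ = ‖ℓ‖ * ‖v‖ * ‖L t ^ N‖ := by ring
    _ ≤ (‖ℓ‖ * ‖v‖ + 1) * (C * ρ ^ N) := by
      gcongr
      · linarith
      · exact h3 t ⟨ht, ht'⟩ N
    _ = _ := by ring

end ScalarExpansion

/-! ### The Fejér kernel -/

section FejerKernel

/-- The Fejér kernel, the inverse Fourier transform of `(1 - |t| / T)₊` up to a constant. -/
def fejer (T u : ℝ) : ℝ := ∫ t in (0 : ℝ)..T, 2 * (1 - t / T) * Real.cos (t * u)

theorem fejer_eq {T u : ℝ} (hT : 0 < T) (hu : u ≠ 0) :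
    fejer T u = 2 * (1 - Real.cos (T * u)) / (T * u ^ 2) := by
  have hder : ∀ t : ℝ, HasDerivAt
      (fun t => 2 * (1 - t / T) * Real.sin (t * u) / u - 2 * Real.cos (t * u) / (T * u ^ 2))
      (2 * (1 - t / T) * Real.cos (t * u)) t := by
    intro t
    have h1 : HasDerivAt (fun t : ℝ => t * u) u t := by simpa using (hasDerivAt_id t).mul_const u
    have h2 : HasDerivAt (fun t : ℝ => 2 * (1 - t / T)) (2 * (0 - 1 / T)) t :=
      (((hasDerivAt_id t).div_const T).const_sub 1 |>.const_mul 2).congr_deriv (by simp)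
    have h3 := ((h2.mul h1.sin).div_const u).sub ((h1.cos.const_mul 2).div_const (T * u ^ 2))
    refine h3.congr_deriv ?_
    field_simp
    ring
  rw [fejer, intervalIntegral.integral_eq_sub_of_hasDerivAt (fun t _ => hder t)
    (by apply Continuous.intervalIntegrable; fun_prop)]
  field_simp
  simp
  ring

theorem fejer_neg (T u : ℝ) : fejer T (-u) = fejer T u := by
  simp [fejer]

theorem fejer_zero {T : ℝ} (hT : 0 < T) : fejer T 0 = T := by
  have : ∀ t : ℝ, HasDerivAt (fun t => 2 * t - t ^ 2 / T)
      (2 * (1 - t / T) * Real.cos (t * 0)) t := fun t => by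
    refine (((hasDerivAt_id t).const_mul 2).sub ((hasDerivAt_pow 2 t).div_const T)).congr_deriv ?_
    simp; ring
  rw [fejer, intervalIntegral.integral_eq_sub_of_hasDerivAt (fun t _ => this t)
    (by apply Continuous.intervalIntegrable; fun_prop)]
  field_simp
  ring

theorem fejer_nonneg {T : ℝ} (hT : 0 < T) (u : ℝ) : 0 ≤ fejer T u := by
  rcases eq_or_ne u 0 with rfl | hu
  · rw [fejer_zero hT]; exact hT.le
  · rw [fejer_eq hT hu]
    have := Real.cos_le_one (T * u)
    have : 0 ≤ 1 - Real.cos (T * u) := by linarith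
    positivity

/-- For `|u| ≥ h` one has `2u² ≥ h² + u²`. This form of the tail bound is integrable on the whole
line with an explicit integral, so no integral over the tail alone is needed. -/
theorem fejer_le {T : ℝ} (hT : 0 < T) {h : ℝ} (hh : 0 < h) {u : ℝ} (hu : h ≤ |u|) :
    fejer T u ≤ 8 / T * (h ^ 2 + u ^ 2)⁻¹ := by
  have hu0 : u ≠ 0 := by rintro rfl; simp at hu; linarith
  rw [fejer_eq hT hu0]
  have h1 := Real.neg_one_le_cos (T * u)
  have h2 : h ^ 2 ≤ u ^ 2 := by rw [← sq_abs u]; gcongr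
  have h3 : 0 < u ^ 2 := by positivity
  calc 2 * (1 - Real.cos (T * u)) / (T * u ^ 2) ≤ 4 / (T * u ^ 2) := by gcongr; linarith
    _ = 8 / (T * (u ^ 2 + u ^ 2)) := by field_simp; norm_num
    _ ≤ 8 / (T * (h ^ 2 + u ^ 2)) := by gcongr
    _ = _ := by field_simp

theorem fejer_le_two_mul {T : ℝ} (hT : 0 < T) (u : ℝ) : fejer T u ≤ 2 * T := by
  have h : ‖fejer T u‖ ≤ 2 * |T - 0| := by
    refine intervalIntegral.norm_integral_le_of_norm_le_const fun t ht => ?_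
    rw [Set.uIoc_of_le hT.le] at ht
    have h1 : 0 ≤ 1 - t / T := by
      rw [sub_nonneg, div_le_one hT]; exact ht.2
    have h2 : 1 - t / T ≤ 1 := by 
      have h3 := ht.1
      have : 0 < t / T := by positivity
      linarith
    rw [norm_mul, norm_mul, Real.norm_eq_abs, Real.norm_eq_abs, Real.norm_eq_abs,
      abs_of_nonneg h1, abs_of_pos (by norm_num : (0:ℝ) < 2)]
    nlinarith [Real.abs_cos_le_one (t * u), abs_nonneg (Real.cos (t * u))]
  rw [sub_zero, abs_of_pos hT] at h
  exact (le_abs_self _).trans h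

theorem continuous_fejer (T : ℝ) : Continuous (fejer T) := by
  refine intervalIntegral.continuous_parametric_intervalIntegral_of_continuous'
    (f := fun u t => 2 * (1 - t / T) * Real.cos (t * u)) ?_ 0 T
  fun_prop

theorem integrable_inv_sq_add_sq {h : ℝ} (hh : 0 < h) :
    Integrable (fun u : ℝ => (h ^ 2 + u ^ 2)⁻¹) ∧ ∫ u : ℝ, (h ^ 2 + u ^ 2)⁻¹ = Real.pi / h := by
  have h1 : (fun u : ℝ => (h ^ 2 + u ^ 2)⁻¹) =
      fun u => h⁻¹ ^ 2 * (fun v : ℝ => (1 + v ^ 2)⁻¹) (h⁻¹ * u) := by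
    ext u
    field_simp
  rw [h1]
  constructor
  · exact (integrable_inv_one_add_sq.comp_mul_left' (by positivity)).const_mul _
  · rw [integral_const_mul, Measure.integral_comp_mul_left (fun v : ℝ => (1 + v ^ 2)⁻¹),
      integral_univ_inv_one_add_sq]
    rw [inv_inv, abs_of_pos hh, smul_eq_mul]
    field_simp

theorem integrable_fejer {T : ℝ} (hT : 0 < T) : Integrable (fejer T) := by
  refine ((integrable_inv_sq_add_sq (one_pos)).1.const_mul (4 * T + 8 / T)).mono'
    (continuous_fejer T).aestronglyMeasurable (ae_of_all _ fun u => ?_)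
  rw [Real.norm_eq_abs, abs_of_nonneg (fejer_nonneg hT u)]
  have h0 : 0 ≤ 8 / T := by positivity
  rcases le_total 1 |u| with h | h
  · refine (fejer_le hT one_pos h).trans ?_
    gcongr
    linarith
  · refine (fejer_le_two_mul hT u).trans ?_
    rw [← div_eq_mul_inv, le_div_iff₀ (by positivity)]
    have : u ^ 2 ≤ 1 := by rw [← sq_abs]; nlinarith [abs_nonneg u]
    nlinarith

theorem integral_fejer {T : ℝ} (hT : 0 < T) : ∫ u, fejer T u = ∫ u, fejer 1 u := by
  have h1 : ∫ u, fejer T u = ∫ u, T * fejer 1 (T * u) := by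
    refine integral_congr_ae ?_
    filter_upwards [compl_mem_ae_iff.2 (measure_singleton (0 : ℝ))] with u hu
    have hu' : u ≠ 0 := hu
    rw [fejer_eq hT hu', fejer_eq one_pos (by positivity)]
    field_simp
  rw [h1, integral_const_mul, Measure.integral_comp_mul_left, abs_of_pos (by positivity),
    smul_eq_mul, ← mul_assoc, mul_inv_cancel₀ hT.ne', one_mul]

/-- Only positivity of the total mass matters: its value is absorbed in the constant of Esseen's
inequality. -/
theorem integral_fejer_one_pos : 0 < ∫ u, fejer 1 u := by
  rw [integral_pos_iff_support_of_nonneg (fejer_nonneg one_pos) (integrable_fejer one_pos)]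
  refine lt_of_lt_of_le ?_ (measure_mono (s := Set.Ioo 1 2) fun u hu => ?_)
  · simp
  · have h1 : (0 : ℝ) < u := by linarith [hu.1]
    rw [Function.mem_support, fejer_eq one_pos h1.ne']
    have h2 : Real.cos u < 1 := by
      rw [← Real.cos_zero]
      exact Real.cos_lt_cos_of_nonneg_of_le_pi le_rfl (by linarith [hu.2, Real.pi_gt_three]) h1
    have h3 : 0 < 1 - Real.cos (1 * u) := by rw [one_mul]; linarith
    positivity

end FejerKernel

/-! ### From a smoothed bound to a pointwise bound -/

section Smoothing

/-- Since `Δ` decreases with slope at most `m`, a value `3η/4` at `x₀` keeps it above `η/2` on `[x₀,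
x₀ + 2h]` with `h = η/(8m)`. The average centred at `x₀ + h` is then at least `η/2` times the mass
of `k`, minus `3η/2` times its mass outside `[-h, h]`; that loss is at most `96π m/T`. -/
theorem le_of_smoothed_le {Δ : ℝ → ℝ} {m T η β c x₀ : ℝ} {k : ℝ → ℝ} (hm : 0 < m) (hT : 0 < T)
    (hη : 0 < η) (hb : ∀ x, -η ≤ Δ x) (hx₀ : 3 / 4 * η ≤ Δ x₀)
    (hmono : ∀ x s, 0 ≤ s → Δ x - m * s ≤ Δ (x + s))
    (hk : Integrable k) (hk0 : ∀ u, 0 ≤ k u)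
    (hktail : ∀ h, 0 < h → ∀ u, h ≤ |u| → k u ≤ 8 / T * (h ^ 2 + u ^ 2)⁻¹)
    (hc : ∫ u, k u = c) (hint : ∀ x, Integrable fun y => Δ (x - y) * k y)
    (hβ : ∀ x, ∫ y, Δ (x - y) * k y ≤ β) :
    η * c ≤ 2 * β + 192 * Real.pi * (m / T) := by
  set h := η / (8 * m) with hh
  have hh0 : 0 < h := by positivity
  have hmh : m * h = η / 8 := by rw [hh]; field_simp
  obtain ⟨hi, hival⟩ := integrable_inv_sq_add_sq hh0
  have hpt : ∀ y, η / 2 * k y - 3 * η / 2 * (8 / T * (h ^ 2 + y ^ 2)⁻¹) ≤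
      Δ (x₀ + h - y) * k y := by
    intro y
    have hpos : 0 ≤ 3 * η / 2 * (8 / T * (h ^ 2 + y ^ 2)⁻¹) := by positivity
    rcases le_total |y| h with hy | hy
    · have hy' := abs_le.1 hy
      have h1 : η / 2 ≤ Δ (x₀ + h - y) := by
        have := hmono x₀ (h - y) (by linarith)
        rw [← add_sub_assoc] at this
        nlinarith
      nlinarith [hk0 y, mul_le_mul_of_nonneg_right h1 (hk0 y)]
    · have h1 := hktail h hh0 y hy
      have h2 := mul_le_mul_of_nonneg_right (hb (x₀ + h - y)) (hk0 y)
      have h3 : 3 * η / 2 * k y ≤ 3 * η / 2 * (8 / T * (h ^ 2 + y ^ 2)⁻¹) := by gcongr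
      linarith
  have hI := integral_mono ((hk.const_mul (η / 2)).sub ((hi.const_mul (8 / T)).const_mul
    (3 * η / 2))) (hint (x₀ + h)) hpt
  rw [integral_sub' (hk.const_mul (η / 2)) ((hi.const_mul (8 / T)).const_mul (3 * η / 2)),
    integral_const_mul, integral_const_mul, integral_const_mul, hival, hc] at hI
  have h4 := hI.trans (hβ _)
  have h5 : 3 * η / 2 * (8 / T * (Real.pi / h)) = 96 * Real.pi * (m / T) := by
    rw [hh]; field_simp; norm_num
  rw [h5] at h4
  linarith

theorem abs_le_of_abs_smoothed_le {Δ : ℝ → ℝ} {m T β M : ℝ} (hm : 0 < m) (hT : 0 < T)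
    (hM : ∀ x, |Δ x| ≤ M) (hmono : ∀ x s, 0 ≤ s → Δ x - m * s ≤ Δ (x + s))
    (hint : ∀ x, Integrable fun y => Δ (x - y) * fejer T y)
    (hβ : ∀ x, |∫ y, Δ (x - y) * fejer T y| ≤ β) (x : ℝ) :
    |Δ x| * (∫ u, fejer 1 u) ≤ 2 * β + 192 * Real.pi * (m / T) := by
  set η := ⨆ x, |Δ x| with hη
  have hbdd : BddAbove (Set.range fun x => |Δ x|) := ⟨M, by rintro _ ⟨x, rfl⟩; exact hM x⟩
  have hle : ∀ x, |Δ x| ≤ η := fun x => le_ciSup hbdd x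
  have hc := integral_fejer_one_pos
  have hβ0 : 0 ≤ β := (abs_nonneg _).trans (hβ 0)
  have hpi := Real.pi_pos
  rcases (abs_nonneg (Δ x)).eq_or_lt with h0 | h0
  · rw [← h0, zero_mul]; positivity
  have hη0 : 0 < η := h0.trans_le (hle x)
  refine (mul_le_mul_of_nonneg_right (hle x) hc.le).trans ?_
  obtain ⟨x₀, hx₀⟩ := exists_lt_of_lt_ciSup (show 3 / 4 * η < ⨆ x, |Δ x| by rw [← hη]; linarith)
  rcases le_total 0 (Δ x₀) with hs | hs
  · rw [abs_of_nonneg hs] at hx₀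
    exact le_of_smoothed_le hm hT hη0 (fun y => (abs_le.1 (hle y)).1) hx₀.le hmono
      (integrable_fejer hT) (fejer_nonneg hT) (fun h hh u hu => fejer_le hT hh hu)
      (integral_fejer hT) hint (fun y => (abs_le.1 (hβ y)).2)
  · rw [abs_of_nonpos hs] at hx₀
    -- If the near-extremal value is negative, pass to `x ↦ -Δ (-x)`: this preserves the one-sided
    -- slope condition, and the kernel is even.
    have hrefl : ∀ y, (fun z => (fun x => -Δ (-x)) (y - z) * fejer T z) =
        fun z => -((fun z => Δ (-y - z) * fejer T z) (-z)) := by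
      intro y; ext z
      simp only [fejer_neg]
      rw [neg_sub, sub_neg_eq_add, neg_add_eq_sub]; ring
    refine le_of_smoothed_le (Δ := fun x => -Δ (-x)) (x₀ := -x₀) (k := fejer T) hm hT hη0 ?_ ?_ ?_
      (integrable_fejer hT) (fejer_nonneg hT) (fun h hh u hu => fejer_le hT hh hu)
      (integral_fejer hT) ?_ ?_
    · intro y; have := (abs_le.1 (hle (-y))).2; linarith
    · simp only [neg_neg]; exact hx₀.le
    · intro y s hs'
      have := hmono (-(y + s)) s hs'
      rw [show -(y + s) + s = -y by ring] at this
      linarith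
    · intro y
      rw [hrefl]
      exact ((hint (-y)).comp_neg).neg
    · intro y
      rw [hrefl, integral_neg, integral_neg_eq_self (fun z => Δ (-y - z) * fejer T z)]
      have := (abs_le.1 (hβ (-y))).1
      linarith

end Smoothing

/-! ### Fourier representation of smoothed distribution functions -/

section SmoothedCdf

variable {ν : Measure ℝ} {h : ℝ → ℝ}

theorem measurableSet_le_sub (x : ℝ) : MeasurableSet {p : ℝ × ℝ | p.2 ≤ x - p.1} :=
  measurableSet_le measurable_snd (measurable_const.sub measurable_fst)

theorem integrable_indicator_mul {k : ℝ → ℝ} (hh : Integrable h ν) (hk : Integrable k) (x : ℝ) :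
    Integrable (fun p : ℝ × ℝ => {p : ℝ × ℝ | p.2 ≤ x - p.1}.indicator
      (fun p => k p.1 * h p.2) p) (volume.prod ν) :=
  (hk.mul_prod hh).indicator (measurableSet_le_sub x)

theorem integral_indicator_snd (k : ℝ → ℝ) (x y : ℝ) :
    ∫ w, {p : ℝ × ℝ | p.2 ≤ x - p.1}.indicator (fun p => k p.1 * h p.2) (y, w) ∂ν =
      (∫ w in Set.Iic (x - y), h w ∂ν) * k y := by
  rw [mul_comm, ← integral_const_mul, ← integral_indicator measurableSet_Iic]
  rfl

theorem integral_indicator_fst (k : ℝ → ℝ) (x w : ℝ) :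
    ∫ y, {p : ℝ × ℝ | p.2 ≤ x - p.1}.indicator (fun p => k p.1 * h p.2) (y, w) =
      h w * ∫ y in Set.Iic (x - w), k y := by
  rw [← integral_const_mul, ← integral_indicator measurableSet_Iic]
  refine integral_congr_ae (ae_of_all _ fun y => ?_)
  simp only [Set.indicator, Set.mem_ofPred_eq, Set.mem_Iic]
  have : w ≤ x - y ↔ y ≤ x - w := by constructor <;> intro h <;> linarith
  simp only [this, mul_comm]

theorem integrable_cdf_mul [SFinite ν] {k : ℝ → ℝ} (hh : Integrable h ν) (hk : Integrable k) (x : ℝ) :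
    Integrable fun y => (∫ w in Set.Iic (x - y), h w ∂ν) * k y := by
  have := (integrable_indicator_mul hh hk x).integral_prod_left
  simpa only [integral_indicator_snd] using this

theorem integrable_mul_antideriv [SFinite ν] {k : ℝ → ℝ} (hh : Integrable h ν) (hk : Integrable k) (x : ℝ) :
    Integrable (fun w => h w * ∫ y in Set.Iic (x - w), k y) ν := by
  have := (integrable_indicator_mul hh hk x).integral_prod_right
  simpa only [integral_indicator_fst] using this

theorem integral_cdf_mul [SFinite ν] {k : ℝ → ℝ} (hh : Integrable h ν) (hk : Integrable k) (x : ℝ) :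
    ∫ y, (∫ w in Set.Iic (x - y), h w ∂ν) * k y = ∫ w, h w * (∫ y in Set.Iic (x - w), k y) ∂ν := by
  have := integral_integral_swap (μ := volume) (ν := ν)
    (f := fun y w => {p : ℝ × ℝ | p.2 ≤ x - p.1}.indicator (fun p => k p.1 * h p.2) (y, w))
    (integrable_indicator_mul hh hk x)
  simpa only [integral_indicator_snd, integral_indicator_fst] using this

theorem abs_setIntegral_Iic_le (hh : Integrable h ν) (z : ℝ) :
    |∫ w in Set.Iic z, h w ∂ν| ≤ ∫ w, |h w| ∂ν := by
  refine (abs_integral_le_integral_abs).trans ?_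
  exact setIntegral_le_integral hh.abs (ae_of_all _ fun w => abs_nonneg _)

theorem tendsto_setIntegral_Iic_atBot (hh : Integrable h ν) :
    Tendsto (fun z => ∫ w in Set.Iic z, h w ∂ν) atBot (𝓝 0) := by
  have h1 : ∀ z, ∫ w in Set.Iic z, h w ∂ν = ∫ w, (Set.Iic z).indicator h w ∂ν := fun z =>
    (integral_indicator measurableSet_Iic).symm
  simp only [h1]
  rw [← integral_zero ℝ ℝ (μ := ν)]
  refine tendsto_integral_filter_of_dominated_convergence (fun w => ‖h w‖)
    (Eventually.of_forall fun z => (hh.indicator measurableSet_Iic).aestronglyMeasurable)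
    (Eventually.of_forall fun z => ae_of_all _ fun w => norm_indicator_le_norm_self _ _)
    hh.norm (ae_of_all _ fun w => ?_)
  refine tendsto_const_nhds.congr' ?_
  filter_upwards [eventually_lt_atBot w] with z hz
  rw [Set.indicator_of_notMem (by simpa using hz)]

/-- Allows the base point `a` in the difference formula below to be sent to `-∞`. -/
theorem tendsto_smoothed_cdf_atBot [SFinite ν] {k : ℝ → ℝ} (hh : Integrable h ν) (hk : Integrable k) :
    Tendsto (fun x => ∫ y, (∫ w in Set.Iic (x - y), h w ∂ν) * k y) atBot (𝓝 0) := by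
  rw [← integral_zero ℝ ℝ (μ := volume)]
  refine tendsto_integral_filter_of_dominated_convergence (fun y => (∫ w, |h w| ∂ν) * ‖k y‖)
    (Eventually.of_forall fun x => (integrable_cdf_mul hh hk x).aestronglyMeasurable)
    (Eventually.of_forall fun x => ae_of_all _ fun y => ?_) (hk.norm.const_mul _)
    (ae_of_all _ fun y => ?_)
  · rw [norm_mul]
    gcongr
    exact abs_setIntegral_Iic_le hh _
  · have : Tendsto (fun x : ℝ => x - y) atBot atBot := tendsto_atBot_add_const_right _ _ tendsto_id
    simpa using ((tendsto_setIntegral_Iic_atBot hh).comp this).mul_const (k y)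

/-- `∫_a^x e^{-itu} du`. -/
def oscInt (a x t : ℝ) : ℂ := ∫ u in a..x, Complex.exp (-(Complex.I * t * u))

/-- The bound does not depend on the endpoints, so it survives `a → -∞`; it is the source of the
weight `1/t` in Esseen's inequality. -/
theorem norm_oscInt_le {a x t : ℝ} (ht : 0 < t) : ‖oscInt a x t‖ ≤ 2 / t := by
  have hc : -(Complex.I * t) ≠ 0 := by simp [ht.ne']
  have h1 : oscInt a x t = (Complex.exp (-(Complex.I * t) * x) - Complex.exp (-(Complex.I * t) * a))
      / (-(Complex.I * t)) := by
    rw [← integral_exp_mul_complex hc, oscInt]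
    congr 1; ext u; ring_nf
  have h2 : ∀ r : ℝ, ‖Complex.exp (-(Complex.I * t) * r)‖ = 1 := fun r => by
    rw [show -(Complex.I * t) * r = ((-(t * r) : ℝ) : ℂ) * Complex.I by push_cast; ring]
    exact Complex.norm_exp_ofReal_mul_I _
  rw [h1, norm_div, norm_neg, norm_mul, Complex.norm_I, one_mul, Complex.norm_real,
    Real.norm_eq_abs, abs_of_pos ht]
  gcongr
  refine (norm_sub_le _ _).trans ?_
  rw [h2, h2]; norm_num

theorem norm_oscInt_le_sub {a x : ℝ} (hax : a ≤ x) (t : ℝ) : ‖oscInt a x t‖ ≤ x - a := by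
  have := intervalIntegral.norm_integral_le_of_norm_le_const (a := a) (b := x) (C := 1)
    (f := fun u : ℝ => Complex.exp (-(Complex.I * t * u))) fun u _ => by
      rw [show -(Complex.I * t * u) = ((-(t * u) : ℝ) : ℂ) * Complex.I by push_cast; ring,
        Complex.norm_exp_ofReal_mul_I]
  rwa [one_mul, abs_of_nonneg (by linarith)] at this

theorem continuous_oscInt (a x : ℝ) : Continuous (oscInt a x) := by
  refine intervalIntegral.continuous_parametric_intervalIntegral_of_continuous'
    (f := fun t u => Complex.exp (-(Complex.I * (t : ℝ) * (u : ℝ)))) ?_ a x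
  fun_prop

theorem integral_cos_eq_re_oscInt (a x t w : ℝ) :
    ∫ u in a..x, Real.cos (t * (u - w)) =
      (oscInt a x t * Complex.exp (Complex.I * t * w)).re := by
  rw [oscInt, ← intervalIntegral.integral_mul_const]
  have h1 : ∀ u : ℝ, Real.cos (t * (u - w)) =
      Complex.reCLM (Complex.exp (-(Complex.I * t * u)) * Complex.exp (Complex.I * t * w)) := by
    intro u
    rw [← Complex.exp_add, show -(Complex.I * t * u) + Complex.I * t * w =
      ((-(t * (u - w)) : ℝ) : ℂ) * Complex.I by push_cast; ring]
    rw [Complex.reCLM_apply, Complex.exp_ofReal_mul_I_re, Real.cos_neg]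
  simp only [h1]
  rw [ContinuousLinearMap.intervalIntegral_comp_comm]
  · rfl
  · apply Continuous.intervalIntegrable; fun_prop

theorem integral_fejer_sub (T : ℝ) {a x : ℝ} (hT : 0 < T) (hax : a ≤ x) (w : ℝ) :
    (∫ y in Set.Iic (x - w), fejer T y) - ∫ y in Set.Iic (a - w), fejer T y =
      ∫ t in (0 : ℝ)..T, 2 * (1 - t / T) *
        (oscInt a x t * Complex.exp (Complex.I * t * w)).re := by
  rw [intervalIntegral.integral_Iic_sub_Iic (integrable_fejer hT).integrableOn
    (integrable_fejer hT).integrableOn]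
  rw [← intervalIntegral.integral_comp_sub_right (fun y => fejer T y) w]
  simp only [fejer, ← integral_cos_eq_re_oscInt, ← intervalIntegral.integral_const_mul]
  rw [intervalIntegral.integral_of_le hax, intervalIntegral.integral_of_le hT.le]
  simp only [intervalIntegral.integral_of_le hax, intervalIntegral.integral_of_le hT.le]
  refine integral_integral_swap (f := fun u t => 2 * (1 - t / T) * Real.cos (t * (u - w))) ?_
  rw [Measure.prod_restrict]
  refine IntegrableOn.mono_set (t := Set.Icc a x ×ˢ Set.Icc 0 T) ?_
    (Set.prod_mono Set.Ioc_subset_Icc_self Set.Ioc_subset_Icc_self)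
  refine ContinuousOn.integrableOn_compact (isCompact_Icc.prod isCompact_Icc) ?_
  apply Continuous.continuousOn
  unfold Function.uncurry
  fun_prop

/-- Fubini twice. Taking a difference at two points keeps every integral absolutely convergent and
replaces the singular factor `1/t` by `oscInt`. The general `ν` and `h` cover both the law itself
(`h = 1`) and the approximating density (`ν` Lebesgue). -/
theorem smoothed_cdf_sub [SFinite ν] {a x T : ℝ} (hh : Integrable h ν) (hT : 0 < T) (hax : a ≤ x) :
    (∫ y, (∫ w in Set.Iic (x - y), h w ∂ν) * fejer T y) -
      (∫ y, (∫ w in Set.Iic (a - y), h w ∂ν) * fejer T y) =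
    ∫ t in (0 : ℝ)..T, 2 * (1 - t / T) *
      (oscInt a x t * ∫ w, Complex.exp (Complex.I * t * w) * h w ∂ν).re := by
  have hk := integrable_fejer hT
  rw [integral_cdf_mul hh hk, integral_cdf_mul hh hk, ← integral_sub
    (integrable_mul_antideriv hh hk x) (integrable_mul_antideriv hh hk a)]
  simp only [← mul_sub, integral_fejer_sub T hT hax]
  have h1 : ∀ t : ℝ, 2 * (1 - t / T) *
      (oscInt a x t * ∫ w, Complex.exp (Complex.I * t * w) * h w ∂ν).re =
      ∫ w, h w * (2 * (1 - t / T) * (oscInt a x t * Complex.exp (Complex.I * t * w)).re) ∂ν := by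
    intro t
    have hi : Integrable (fun w : ℝ => oscInt a x t * (Complex.exp (Complex.I * t * w) * h w)) ν := by
      refine Integrable.const_mul ?_ _
      refine hh.ofReal.bdd_mul (c := 1) (by fun_prop) (ae_of_all _ fun w => ?_)
      rw [show Complex.I * t * w = ((t * w : ℝ) : ℂ) * Complex.I by push_cast; ring,
        Complex.norm_exp_ofReal_mul_I]
    rw [← integral_const_mul, ← Complex.reCLM_apply, ← ContinuousLinearMap.integral_comp_comm _ hi,
      ← integral_const_mul]
    refine integral_congr_ae (ae_of_all _ fun w => ?_)
    simp only [Complex.reCLM_apply]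
    rw [← mul_assoc, Complex.re_mul_ofReal]
    ring
  simp only [h1, ← intervalIntegral.integral_const_mul]
  simp only [intervalIntegral.integral_of_le hT.le]
  refine integral_integral_swap (f := fun w t => h w * (2 * (1 - t / T) *
    (oscInt a x t * Complex.exp (Complex.I * t * w)).re)) ?_
  have hcont : Continuous (fun p : ℝ × ℝ => 2 * (1 - p.2 / T) *
      (oscInt a x p.2 * Complex.exp (Complex.I * p.2 * p.1)).re) := by
    have := continuous_oscInt a x
    fun_prop
  have hi2 : Integrable (fun p : ℝ × ℝ => h p.1 * (1 : ℝ))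
      (ν.prod (volume.restrict (Set.Ioc 0 T))) := hh.mul_prod (integrable_const _)
  simp only [mul_one] at hi2
  refine hi2.mul_bdd (c := 2 * (x - a)) hcont.aestronglyMeasurable ?_
  have hmem : ∀ᵐ p : ℝ × ℝ ∂ν.prod (volume.restrict (Set.Ioc 0 T)), p.2 ∈ Set.Ioc 0 T :=
    Measure.quasiMeasurePreserving_snd.ae (ae_restrict_mem measurableSet_Ioc)
  filter_upwards [hmem] with p hp
  have h2 : |1 - p.2 / T| ≤ 1 := by
    have h3 : 0 < p.2 / T := div_pos hp.1 hT
    have h4 : p.2 / T ≤ 1 := (div_le_one hT).2 hp.2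
    rw [abs_le]; constructor <;> linarith
  have h3 : |(oscInt a x p.2 * Complex.exp (Complex.I * p.2 * p.1)).re| ≤ x - a := by
    refine (Complex.abs_re_le_norm _).trans ?_
    rw [norm_mul, show Complex.I * p.2 * p.1 = ((p.2 * p.1 : ℝ) : ℂ) * Complex.I by
      push_cast; ring, Complex.norm_exp_ofReal_mul_I, mul_one]
    exact norm_oscInt_le_sub hax _
  rw [norm_mul, norm_mul, Real.norm_eq_abs, Real.norm_eq_abs, Real.norm_eq_abs,
    abs_of_pos (by norm_num : (0 : ℝ) < 2)]
  nlinarith [abs_nonneg (1 - p.2 / T),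
    abs_nonneg (oscInt a x p.2 * Complex.exp (Complex.I * p.2 * p.1)).re]

theorem continuous_fourier (hh : Integrable h ν) :
    Continuous fun t : ℝ => ∫ w : ℝ, Complex.exp (Complex.I * t * w) * h w ∂ν := by
  refine continuous_of_dominated (bound := fun w => ‖h w‖) (fun t => ?_)
    (fun t => ae_of_all _ fun w => ?_) hh.norm (ae_of_all _ fun w => by fun_prop)
  · exact (by fun_prop : Continuous fun w : ℝ =>
      Complex.exp (Complex.I * t * w)).aestronglyMeasurable.mul hh.ofReal.aestronglyMeasurable
  · rw [norm_mul, show Complex.I * t * w = ((t * w : ℝ) : ℂ) * Complex.I by push_cast; ring,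
      Complex.norm_exp_ofReal_mul_I, one_mul, Complex.norm_real]

end SmoothedCdf

/-- Esseen's smoothing inequality. -/
theorem exists_esseen_const : ∃ C : ℝ, 0 < C ∧ ∀ (μ : Measure ℝ) [IsProbabilityMeasure μ]
    (q : ℝ → ℝ) (m T : ℝ) (b : ℝ → ℝ), 0 < m → 0 < T → Integrable q → (∀ x, |q x| ≤ m) →
    IntervalIntegrable b volume 0 T →
    (∀ t ∈ Set.Ioc 0 T, ‖(∫ w : ℝ, Complex.exp (Complex.I * t * w) ∂μ) -
      ∫ w : ℝ, Complex.exp (Complex.I * t * w) * q w‖ ≤ t * b t) →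
    ∀ x, |μ.real (Set.Iic x) - ∫ y in Set.Iic x, q y| ≤ C * ((∫ t in (0 : ℝ)..T, b t) + m / T) := by
  have hc := integral_fejer_one_pos
  have hpi := Real.pi_pos
  -- The smoothed difference is at most `4∫b`, and unsmoothing doubles it and adds `192π m/T`; hence
  -- `8 + 192π`, divided by the kernel mass.
  refine ⟨(8 + 192 * Real.pi) / ∫ u, fejer 1 u, by positivity, ?_⟩
  intro μ _ q m T b hm hT hq hqm hb hbound x
  have h1 : Integrable (fun _ : ℝ => (1 : ℝ)) μ := integrable_const _
  have hF : ∀ z, μ.real (Set.Iic z) = ∫ w in Set.Iic z, (1 : ℝ) ∂μ := fun z => by simp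
  set Δ : ℝ → ℝ := fun z => (∫ w in Set.Iic z, (1 : ℝ) ∂μ) - ∫ y in Set.Iic z, q y with hΔ
  have hk := integrable_fejer hT
  have hΔk : ∀ z, (fun y => Δ (z - y) * fejer T y) = fun y =>
      (∫ w in Set.Iic (z - y), (1 : ℝ) ∂μ) * fejer T y -
        (∫ w in Set.Iic (z - y), q w) * fejer T y := fun z => by
    ext y; simp only [hΔ, sub_mul]
  have hint : ∀ z, Integrable fun y => Δ (z - y) * fejer T y := fun z => by
    rw [hΔk]; exact (integrable_cdf_mul h1 hk z).sub (integrable_cdf_mul hq hk z)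
  have hD : ∀ z, ∫ y, Δ (z - y) * fejer T y =
      (∫ y, (∫ w in Set.Iic (z - y), (1 : ℝ) ∂μ) * fejer T y) -
        ∫ y, (∫ w in Set.Iic (z - y), q w) * fejer T y := fun z => by
    rw [hΔk, integral_sub (integrable_cdf_mul h1 hk z) (integrable_cdf_mul hq hk z)]
  have hb0 : ∀ t ∈ Set.Ioc 0 T, 0 ≤ b t := fun t ht => by
    have := (norm_nonneg _).trans (hbound t ht)
    exact nonneg_of_mul_nonneg_right this ht.1
  have hbint : 0 ≤ ∫ t in (0 : ℝ)..T, b t := by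
    rw [intervalIntegral.integral_of_le hT.le]
    exact setIntegral_nonneg measurableSet_Ioc hb0
  have hdiff : ∀ z a, a ≤ z → |(∫ y, Δ (z - y) * fejer T y) - ∫ y, Δ (a - y) * fejer T y| ≤
      4 * ∫ t in (0 : ℝ)..T, b t := by
    intro z a haz
    have hcont : ∀ {ν : Measure ℝ} {h : ℝ → ℝ}, Integrable h ν → IntervalIntegrable
        (fun t : ℝ => 2 * (1 - t / T) *
          (oscInt a z t * ∫ w : ℝ, Complex.exp (Complex.I * t * w) * h w ∂ν).re) volume 0 T := by
      intro ν h hh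
      apply Continuous.intervalIntegrable
      have := continuous_oscInt a z
      have := continuous_fourier hh
      fun_prop
    rw [hD, hD, sub_sub_sub_comm, smoothed_cdf_sub h1 hT haz, smoothed_cdf_sub hq hT haz,
      ← intervalIntegral.integral_sub (hcont h1) (hcont hq), ← Real.norm_eq_abs,
      ← intervalIntegral.integral_const_mul]
    refine intervalIntegral.norm_integral_le_of_norm_le hT.le (ae_of_all _ fun t ht => ?_)
      (hb.const_mul 4)
    rw [← mul_sub, ← Complex.sub_re, ← mul_sub, Real.norm_eq_abs, abs_mul]
    have hbt := hbound t ht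
    simp only [Complex.ofReal_one, mul_one]
    have h2 : |2 * (1 - t / T)| ≤ 2 := by
      have h3 : 0 < t / T := div_pos ht.1 hT
      have h4 : t / T ≤ 1 := (div_le_one hT).2 ht.2
      rw [abs_le]; constructor <;> linarith
    calc _ ≤ 2 * (2 / t * (t * b t)) := by
          gcongr
          refine (Complex.abs_re_le_norm _).trans ?_
          rw [norm_mul]
          have := ht.1
          gcongr
          exact norm_oscInt_le ht.1
      _ = 4 * b t := by have := ht.1; field_simp; ring
  have htend : Tendsto (fun a => ∫ y, Δ (a - y) * fejer T y) atBot (𝓝 0) := by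
    simp only [hD]
    simpa using (tendsto_smoothed_cdf_atBot h1 hk).sub (tendsto_smoothed_cdf_atBot hq hk)
  have hβ : ∀ z, |∫ y, Δ (z - y) * fejer T y| ≤ 4 * ∫ t in (0 : ℝ)..T, b t := by
    intro z
    have h2 := (htend.const_sub (∫ y, Δ (z - y) * fejer T y)).abs
    rw [sub_zero] at h2
    refine le_of_tendsto h2 ?_
    filter_upwards [eventually_le_atBot z] with a ha using hdiff z a ha
  -- The distribution function of `μ` increases, and the integral of `q` grows with slope at most
  -- `m`.
  have hmono : ∀ x s, 0 ≤ s → Δ x - m * s ≤ Δ (x + s) := by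
    intro x s hs
    have h2 : μ.real (Set.Iic x) ≤ μ.real (Set.Iic (x + s)) :=
      measureReal_mono (Set.Iic_subset_Iic.2 (by linarith))
    have h3 : (∫ y in Set.Iic (x + s), q y) - ∫ y in Set.Iic x, q y ≤ m * s := by
      rw [intervalIntegral.integral_Iic_sub_Iic hq.integrableOn hq.integrableOn]
      refine (le_abs_self _).trans ?_
      have := intervalIntegral.norm_integral_le_of_norm_le_const (a := x) (b := x + s) (f := q)
        (C := m) fun t _ => hqm t
      rwa [add_sub_cancel_left, abs_of_nonneg hs] at this
    simp only [hΔ, ← hF]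
    linarith
  have hM : ∀ z, |Δ z| ≤ (∫ _, |(1 : ℝ)| ∂μ) + ∫ w, |q w| := fun z =>
    (abs_sub _ _).trans (add_le_add (abs_setIntegral_Iic_le h1 z) (abs_setIntegral_Iic_le hq z))
  have hfin := abs_le_of_abs_smoothed_le hm hT hM hmono hint hβ x
  rw [hF]
  change |Δ x| ≤ _
  rw [div_mul_eq_mul_div, le_div_iff₀ hc]
  have hmT : 0 ≤ m / T := by positivity
  nlinarith [mul_nonneg hpi.le hbint]

/-! ### Gaussian densities with polynomial factors -/

section GaussianPolynomial

open Polynomial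

variable {V : ℝ≥0}

/-- The polynomial `Dp` with `(p 𝔫)' = (Dp) 𝔫`. -/
def gaussDeriv (V : ℝ≥0) (p : ℝ[X]) : ℝ[X] := derivative p - C (V : ℝ)⁻¹ * X * p

/-- The product of a polynomial with the centred normal density. -/
def polyGauss (V : ℝ≥0) (p : ℝ[X]) (x : ℝ) : ℝ := p.eval x * gaussianPDFReal 0 V x

theorem hasDerivAt_gaussianPDFReal (V : ℝ≥0) (x : ℝ) :
    HasDerivAt (gaussianPDFReal 0 V) (-((V : ℝ)⁻¹ * x) * gaussianPDFReal 0 V x) x := by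
  rcases eq_or_ne V 0 with rfl | hV
  · simp only [gaussianPDFReal_zero_var]
    simp
  have hV' : (V : ℝ) ≠ 0 := by exact_mod_cast hV
  have h1 : HasDerivAt (fun x : ℝ => -(x - 0) ^ 2 / (2 * V)) (-((V : ℝ)⁻¹ * x)) x := by
    refine ((((hasDerivAt_id x).sub_const 0).pow 2).neg.div_const (2 * (V : ℝ))).congr_deriv ?_
    simp; field_simp
  have h2 := h1.exp.const_mul (√(2 * Real.pi * V))⁻¹
  refine h2.congr_deriv ?_
  rw [gaussianPDFReal]; ring

theorem hasDerivAt_polyGauss (p : ℝ[X]) (x : ℝ) :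
    HasDerivAt (polyGauss V p) (polyGauss V (gaussDeriv V p) x) x := by
  refine ((p.hasDerivAt x).mul (hasDerivAt_gaussianPDFReal V x)).congr_deriv ?_
  simp [polyGauss, gaussDeriv]; ring

theorem integrable_polyGauss (hV : V ≠ 0) (p : ℝ[X]) : Integrable (polyGauss V p) := by
  have hV' : (0 : ℝ) < V := by positivity
  induction p using Polynomial.induction_on' with
  | add p q hp hq =>
    have : polyGauss V (p + q) = fun x => polyGauss V p x + polyGauss V q x := by
      ext x; simp [polyGauss, add_mul]
    rw [this]; exact hp.add hq
  | monomial n a =>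
    have h1 := integrable_rpow_mul_exp_neg_mul_sq (b := (2 * (V : ℝ))⁻¹) (by positivity)
      (s := n) (by have : (0 : ℝ) ≤ n := by positivity
                   linarith)
    have : polyGauss V (monomial n a) = fun x => (a * (√(2 * Real.pi * V))⁻¹) *
        (x ^ (n : ℝ) * Real.exp (-(2 * (V : ℝ))⁻¹ * x ^ 2)) := by
      ext x
      simp only [polyGauss, eval_monomial, gaussianPDFReal, Real.rpow_natCast]
      rw [show -(x - 0) ^ 2 / (2 * (V : ℝ)) = -(2 * (V : ℝ))⁻¹ * x ^ 2 by field_simp; ring]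
      ring
    rw [this]; exact h1.const_mul _

theorem integral_Iic_polyGauss (hV : V ≠ 0) (p : ℝ[X]) (z : ℝ) :
    ∫ x in Set.Iic z, polyGauss V (gaussDeriv V p) x = polyGauss V p z := by
  have h1 : Tendsto (polyGauss V p) atBot (𝓝 0) :=
    tendsto_zero_of_hasDerivAt_of_integrableOn_Iic (a := z)
      (fun x _ => hasDerivAt_polyGauss p x) (integrable_polyGauss hV _).integrableOn
      (integrable_polyGauss hV _).integrableOn
  rw [integral_Iic_of_hasDerivAt_of_tendsto' (fun x _ => hasDerivAt_polyGauss p x)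
    (integrable_polyGauss hV _).integrableOn h1, sub_zero]

theorem abs_polyGauss_le (hV : V ≠ 0) (p : ℝ[X]) (z : ℝ) :
    |polyGauss V p z| ≤ ∫ x, |polyGauss V (gaussDeriv V p) x| := by
  rw [← integral_Iic_polyGauss hV]
  exact abs_setIntegral_Iic_le (integrable_polyGauss hV _) z

theorem integrable_exp_mul_polyGauss (hV : V ≠ 0) (p : ℝ[X]) (t : ℝ) :
    Integrable fun x : ℝ => Complex.exp (Complex.I * t * x) * polyGauss V p x := by
  refine (integrable_polyGauss hV p).ofReal.bdd_mul (c := 1) (by fun_prop) (ae_of_all _ fun w => ?_)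
  rw [show Complex.I * t * w = ((t * w : ℝ) : ℂ) * Complex.I by push_cast; ring,
    Complex.norm_exp_ofReal_mul_I]

theorem fourier_gaussDeriv (hV : V ≠ 0) (p : ℝ[X]) (t : ℝ) :
    ∫ x : ℝ, Complex.exp (Complex.I * t * x) * polyGauss V (gaussDeriv V p) x =
      -(Complex.I * t) * ∫ x : ℝ, Complex.exp (Complex.I * t * x) * polyGauss V p x := by
  have hu : ∀ x : ℝ, HasDerivAt (fun x : ℝ => Complex.exp (Complex.I * t * x))
      (Complex.I * t * Complex.exp (Complex.I * t * x)) x := fun x => by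
    have h1 : HasDerivAt (fun z : ℂ => Complex.exp (Complex.I * t * z))
        (Complex.I * t * Complex.exp (Complex.I * t * x)) x := by
      refine ((hasDerivAt_id (x : ℂ)).const_mul (Complex.I * t)).cexp.congr_deriv ?_
      simp; ring
    exact h1.comp_ofReal
  have hv : ∀ x : ℝ, HasDerivAt (fun x : ℝ => (polyGauss V p x : ℂ))
      (polyGauss V (gaussDeriv V p) x : ℂ) x := fun x => (hasDerivAt_polyGauss p x).ofReal_comp
  have h2 : Integrable fun x : ℝ =>
      Complex.I * t * Complex.exp (Complex.I * t * x) * polyGauss V p x := by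
    simp only [mul_assoc (Complex.I * t)]
    exact (integrable_exp_mul_polyGauss hV p t).const_mul _
  rw [integral_mul_deriv_eq_deriv_mul_of_integrable (fun x _ => hu x) (fun x _ => hv x) (integrable_exp_mul_polyGauss hV _ t) h2
    (integrable_exp_mul_polyGauss hV p t)]
  simp only [mul_assoc (Complex.I * t)]
  rw [integral_const_mul, neg_mul]

theorem fourier_gaussianPDFReal (hV : V ≠ 0) (t : ℝ) :
    ∫ x : ℝ, Complex.exp (Complex.I * t * x) * gaussianPDFReal 0 V x =
      Complex.exp (-(V * t ^ 2 / 2)) := by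
  have h1 := charFun_gaussianReal (μ := 0) (v := V) t
  rw [charFun_apply_real, integral_gaussianReal_eq_integral_smul hV] at h1
  rw [show -((V : ℂ) * t ^ 2 / 2) = t * (0 : ℝ) * Complex.I - V * t ^ 2 / 2 by simp, ← h1]
  refine integral_congr_ae (ae_of_all _ fun x => ?_)
  simp only [Complex.real_smul]
  rw [mul_comm, show Complex.I * t * x = t * x * Complex.I by ring]

/-- The first Edgeworth correction and its Fourier transform. -/
theorem exists_edgeworth_correction (hV : V ≠ 0) (b c : ℝ) :
    ∃ (p : ℝ[X]) (q : ℝ → ℝ) (M : ℝ), Integrable q ∧ (∀ x, |q x| ≤ M) ∧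
      (∀ z, ∫ x in Set.Iic z, q x = p.eval z * gaussianPDFReal 0 V z) ∧
      ∀ t : ℝ, ∫ x : ℝ, Complex.exp (Complex.I * t * x) * q x =
        Complex.I * (b * t + c * t ^ 3) * Complex.exp (-(V * t ^ 2 / 2)) := by
  -- With `q = (p𝔫)'` the primitive of `q` is `p𝔫`, as the expansion requires. Each derivative
  -- multiplies the transform by `-it`, so the transform of `q` carries the factor `-it(-b +
  -- c(-it)²) = i(bt + ct³)`.
  set p : ℝ[X] := C (-b) * 1 + C c * gaussDeriv V (gaussDeriv V 1) with hp
  refine ⟨p, polyGauss V (gaussDeriv V p), _, integrable_polyGauss hV _, abs_polyGauss_le hV _,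
    integral_Iic_polyGauss hV p, fun t => ?_⟩
  have h1 : ∫ x : ℝ, Complex.exp (Complex.I * t * x) * polyGauss V 1 x =
      Complex.exp (-(V * t ^ 2 / 2)) := by
    rw [← fourier_gaussianPDFReal hV]; simp [polyGauss]
  have h2 : ∀ x : ℝ, Complex.exp (Complex.I * t * x) * polyGauss V p x =
      (-b) * (Complex.exp (Complex.I * t * x) * polyGauss V 1 x) + c * (
        Complex.exp (Complex.I * t * x) * polyGauss V (gaussDeriv V (gaussDeriv V 1)) x) := by
    intro x
    simp [polyGauss, hp]; ring
  rw [fourier_gaussDeriv hV]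
  simp only [h2]
  rw [integral_add ((integrable_exp_mul_polyGauss hV _ t).const_mul _)
    ((integrable_exp_mul_polyGauss hV _ t).const_mul _), integral_const_mul, integral_const_mul,
    fourier_gaussDeriv hV, fourier_gaussDeriv hV, h1]
  linear_combination (c * t ^ 3 * Complex.I * Complex.exp (-(V * t ^ 2 / 2))) *
    (-1 : ℂ) * Complex.I_sq

end GaussianPolynomial

/-! ### Taylor expansions of the eigenvalue and the amplitude -/

section TaylorExpansion

open Asymptotics

theorem exists_taylor_isLittleO {f : ℝ → ℂ} {n : ℕ} (hf : ContDiffAt ℝ n f 0) :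
    ∃ a : ℕ → ℂ, (fun t : ℝ => f t - ∑ k ∈ Finset.range (n + 1), a k * (t : ℂ) ^ k)
      =o[𝓝 0] fun t : ℝ => t ^ n := by
  obtain ⟨u, hu, hfu⟩ := hf.contDiffOn (m := n) le_rfl (by simp)
  obtain ⟨δ, hδ, hball⟩ := Metric.mem_nhds_iff.1
    (mem_of_superset (by simpa using hu) (Set.Subset.refl u))
  have h0 : (0 : ℝ) ∈ Metric.ball (0 : ℝ) δ := Metric.mem_ball_self hδ
  have h1 := taylor_isLittleO (convex_ball (0 : ℝ) δ) h0 (hfu.mono hball)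
  rw [nhdsWithin_eq_nhds.2 (Metric.ball_mem_nhds _ hδ)] at h1
  refine ⟨fun k => ((k.factorial : ℝ)⁻¹ : ℝ) *
    iteratedDerivWithin k f (Metric.ball (0 : ℝ) δ) 0, ?_⟩
  refine (h1.congr_left fun t => ?_).congr_right fun t => by simp
  rw [taylor_within_apply]
  congr 1
  refine Finset.sum_congr rfl fun k _ => ?_
  simp; ring

/-- Average the Taylor expansion at `t` with the conjugate of the one at `-t`: the function is
unchanged, and each coefficient becomes a real multiple of `i^k`. -/
theorem exists_hermitian_taylor_isLittleO {f : ℝ → ℂ} {n : ℕ} (hf : ContDiffAt ℝ n f 0)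
    (hsym : ∀ᶠ t in 𝓝 (0 : ℝ), f (-t) = (starRingEnd ℂ) (f t)) :
    ∃ r : ℕ → ℝ, (fun t : ℝ => f t - ∑ k ∈ Finset.range (n + 1), r k * (Complex.I * t) ^ k)
      =o[𝓝 0] fun t : ℝ => t ^ n := by
  obtain ⟨a, ha⟩ := exists_taylor_isLittleO hf
  have hneg : Tendsto (fun t : ℝ => -t) (𝓝 0) (𝓝 0) := by
    simpa using (continuous_neg (G := ℝ)).tendsto 0
  have h1 := ha.comp_tendsto hneg
  set S : ℝ → ℂ := fun t => ∑ k ∈ Finset.range (n + 1), a k * (t : ℂ) ^ k with hS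
  have h2 : (fun t : ℝ => (starRingEnd ℂ) (f (-t) - S (-t))) =o[𝓝 0] fun t : ℝ => t ^ n := by
    refine IsLittleO.of_norm_norm ?_
    have := h1.norm_norm
    refine (this.congr_left fun t => ?_).congr_right fun t => ?_
    · rw [Complex.norm_conj]; rfl
    · simp [Function.comp]
  refine ⟨fun k => (a k * (-Complex.I) ^ k).re, ?_⟩
  have h3 := (ha.add h2).const_mul_left (1 / 2 : ℂ)
  refine h3.congr' ?_ EventuallyEq.rfl
  filter_upwards [hsym] with t ht
  have h4 : (starRingEnd ℂ) (f (-t)) = f t := by rw [ht, Complex.conj_conj]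
  rw [map_sub, h4]
  have h5 : ∑ k ∈ Finset.range (n + 1), ((a k * (-Complex.I) ^ k).re : ℂ) * (Complex.I * t) ^ k =
      (1 / 2 : ℂ) * (S t + (starRingEnd ℂ) (S (-t))) := by
    simp only [hS, map_sum, ← Finset.sum_add_distrib, Finset.mul_sum]
    refine Finset.sum_congr rfl fun k _ => ?_
    have h6 : ((a k * (-Complex.I) ^ k).re : ℂ) =
        (a k * (-Complex.I) ^ k + (starRingEnd ℂ) (a k * (-Complex.I) ^ k)) / 2 := by
      rw [Complex.re_eq_add_conj]
    rw [h6]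
    simp only [map_mul, map_pow, map_neg, Complex.conj_I, neg_neg, Complex.conj_ofReal,
      Complex.ofReal_neg]
    have h7 : (-Complex.I) ^ k * (Complex.I) ^ k = 1 := by
      rw [← mul_pow]; simp
    have h8 : Complex.I ^ k * Complex.I ^ k = (-1) ^ k := by rw [← mul_pow]; simp
    rw [mul_pow, neg_pow (t : ℂ)]
    linear_combination (1 / 2 * a k * t ^ k) * h7 + (1 / 2 * (starRingEnd ℂ) (a k) * t ^ k) * h8
  rw [h5]; ring

theorem norm_cexp_neg_I_mul (A t : ℝ) : ‖Complex.exp (-(Complex.I * A * t))‖ = 1 := by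
  rw [show -(Complex.I * A * t) = ((-(A * t) : ℝ) : ℂ) * Complex.I by push_cast; ring]
  exact Complex.norm_exp_ofReal_mul_I _

theorem norm_cexp_gauss (V c t : ℝ) :
    ‖Complex.exp (-(V * t ^ 2 / 2) + Complex.I * c * t ^ 3)‖ = Real.exp (-(V * t ^ 2 / 2)) := by
  rw [show (-(V * t ^ 2 / 2) + Complex.I * c * t ^ 3 : ℂ) =
    ((-(V * t ^ 2 / 2) : ℝ) : ℂ) + ((c * t ^ 3 : ℝ) : ℂ) * Complex.I by push_cast; ring,
    Complex.exp_add, norm_mul, Complex.norm_exp_ofReal_mul_I, mul_one, Complex.norm_exp,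
    Complex.ofReal_re]

theorem isBigO_exp_sub_cubic (A V c : ℝ) :
    (fun t : ℝ => Complex.exp (Complex.I * A * t + (-(V * t ^ 2 / 2) + Complex.I * c * t ^ 3)) -
      (1 + Complex.I * A * t - (V / 2 + A ^ 2 / 2) * t ^ 2 +
        Complex.I * (c - A * V / 2 - A ^ 3 / 6) * t ^ 3)) =O[𝓝 0] fun t : ℝ => t ^ 4 := by
  set w : ℝ → ℂ := fun t => Complex.I * A * t + (-(V * t ^ 2 / 2) + Complex.I * c * t ^ 3) with hw
  have hwt : Tendsto w (𝓝 0) (𝓝 0) := by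
    have : Continuous w := by fun_prop
    simpa [hw] using this.tendsto 0
  have hbd : ∀ {u : ℝ → ℂ}, Continuous u → u =O[𝓝 0] fun _ : ℝ => (1 : ℝ) := fun hu =>
    hu.continuousAt.isBigO_one ℝ
  have hof : (fun t : ℝ => (t : ℂ)) =O[𝓝 0] fun t : ℝ => t :=
    IsBigO.of_bound 1 (by simp)
  have hwO : w =O[𝓝 0] fun t : ℝ => t := by
    have h1 : w = fun t : ℝ => (t : ℂ) *
        (Complex.I * A + (-(V * t / 2) + Complex.I * c * t ^ 2)) := by
      ext t; simp only [hw]; ring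
    rw [h1]
    simpa using hof.mul (hbd (u := fun t : ℝ =>
      (Complex.I * A + (-(V * t / 2) + Complex.I * c * t ^ 2))) (by fun_prop))
  have h2 : (fun t : ℝ => Complex.exp (w t) - ∑ k ∈ Finset.range 4, w t ^ k / k.factorial)
      =O[𝓝 0] fun t : ℝ => t ^ 4 := by
    refine IsBigO.trans ?_ (hwO.pow 4)
    refine IsBigO.of_bound 1 ?_
    have : ∀ᶠ t in 𝓝 (0 : ℝ), ‖w t‖ < 1 := by
      have := hwt.norm
      rw [norm_zero] at this
      exact this.eventually_lt_const one_pos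
    filter_upwards [this] with t ht
    refine (Complex.exp_bound ht.le (n := 4) (by norm_num)).trans ?_
    rw [norm_pow, mul_comm]
    gcongr
    norm_num [Nat.factorial]
  have h3 : (fun t : ℝ => (∑ k ∈ Finset.range 4, w t ^ k / k.factorial) -
      (1 + Complex.I * A * t - (V / 2 + A ^ 2 / 2) * t ^ 2 +
        Complex.I * (c - A * V / 2 - A ^ 3 / 6) * t ^ 3)) =O[𝓝 0] fun t : ℝ => t ^ 4 := by
    have h4 : ∃ u : ℝ → ℂ, Continuous u ∧ ∀ t : ℝ,
        (∑ k ∈ Finset.range 4, w t ^ k / k.factorial) -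
      (1 + Complex.I * A * t - (V / 2 + A ^ 2 / 2) * t ^ 2 +
        Complex.I * (c - A * V / 2 - A ^ 3 / 6) * t ^ 3) = (t : ℂ) ^ 4 * u t := by
      set y : ℝ → ℂ := fun t => -(V / 2) + Complex.I * c * t with hy
      refine ⟨fun t => (y t) ^ 2 / 2 - A * c + (3 * (Complex.I * A) ^ 2 * y t +
        3 * (Complex.I * A) * y t ^ 2 * t + y t ^ 3 * t ^ 2) / 6, by fun_prop, fun t => ?_⟩
      have h5 : w t = Complex.I * A * t + t ^ 2 * y t := by simp only [hw, hy]; ring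
      simp only [Finset.sum_range_succ, Finset.sum_range_zero, h5]
      norm_num [Nat.factorial]
      simp only [hy]
      linear_combination (A ^ 2 * t ^ 2 / 2 + A * c * t ^ 4 +
        A ^ 3 * Complex.I * t ^ 3 / 6 : ℂ) * Complex.I_sq
    obtain ⟨u, hu, h5⟩ := h4
    simp only [h5]
    simpa using (hof.pow 4).mul (hbd hu)
  refine (h2.add h3).congr_left fun t => ?_
  rw [sub_add_sub_cancel]

theorem exists_gaussian_expansion {lam : ℝ → ℂ} (hlam : ContDiffAt ℝ 3 lam 0) (h0 : lam 0 = 1)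
    (hsym : ∀ᶠ t in 𝓝 (0 : ℝ), lam (-t) = (starRingEnd ℂ) (lam t))
    (hle : ∀ᶠ t in 𝓝 (0 : ℝ), ‖lam t‖ ≤ 1) :
    ∃ (A c : ℝ) (V : ℝ≥0), (fun t : ℝ => lam t * Complex.exp (-(Complex.I * A * t)) -
      Complex.exp (-(V * t ^ 2 / 2) + Complex.I * c * t ^ 3)) =o[𝓝 0] fun t : ℝ => t ^ 3 := by
  obtain ⟨r, hr⟩ := exists_hermitian_taylor_isLittleO (n := 3) hlam hsym
  have hr0 : r 0 = 1 := by
    have h1 := (hr.def one_pos).self_of_nhds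
    simp [Finset.sum_range_succ, h0, sub_eq_zero] at h1
    exact_mod_cast h1.symm
  -- These are the choices that match the coefficients of `t`, `t²`, `t³` in `exp(iAt - Vt²/2 +
  -- ict³)` with `r k * (it)^k`.
  set A := r 1 with hA
  set V := 2 * r 2 - A ^ 2 with hV
  set c := -r 3 + A * V / 2 + A ^ 3 / 6 with hc
  have h43 : (fun t : ℝ => t ^ 4) =o[𝓝 0] fun t : ℝ => t ^ 3 := isLittleO_pow_pow (by norm_num)
  have h1 : (fun t : ℝ => lam t - Complex.exp (Complex.I * A * t +
      (-(V * t ^ 2 / 2) + Complex.I * c * t ^ 3))) =o[𝓝 0] fun t : ℝ => t ^ 3 := by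
    refine (hr.sub ((isBigO_exp_sub_cubic A V c).trans_isLittleO h43)).congr_left fun t => ?_
    simp only [Finset.sum_range_succ, Finset.sum_range_zero, hr0, ← hA]
    simp only [hV, hc]
    push_cast
    linear_combination (-(r 2 : ℂ) * t ^ 2 - r 3 * t ^ 3 * Complex.I) * Complex.I_sq
  have h2 : (fun t : ℝ => lam t * Complex.exp (-(Complex.I * A * t)) -
      Complex.exp (-(V * t ^ 2 / 2) + Complex.I * c * t ^ 3)) =o[𝓝 0] fun t : ℝ => t ^ 3 := by
    refine IsLittleO.of_norm_left ?_
    refine h1.norm_left.congr_left fun t => ?_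
    have h3 : Complex.exp (-(V * t ^ 2 / 2) + Complex.I * c * t ^ 3) = Complex.exp (Complex.I * A * t +
      (-(V * t ^ 2 / 2) + Complex.I * c * t ^ 3)) * Complex.exp (-(Complex.I * A * t)) := by
      rw [← Complex.exp_add]; ring_nf
    rw [h3, ← sub_mul, norm_mul, norm_cexp_neg_I_mul, mul_one]
  -- A negative `V` would make `exp(-Vt²/2)` exceed `1` by order `t²`, more than the cubic error can
  -- compensate, contradicting `‖lam t‖ ≤ 1`.
  have hV0 : 0 ≤ V := by
    by_contra hneg
    push Not at hneg
    obtain ⟨δ, hδ, hball⟩ := Metric.eventually_nhds_iff.1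
      ((h2.def (show (0 : ℝ) < -V / 4 by linarith)).and hle)
    set t := min (δ / 2) 1 with ht
    have ht0 : 0 < t := by positivity
    have ht1 : t ≤ 1 := min_le_right _ _
    obtain ⟨h5, h6⟩ := hball (y := t) (by
      rw [dist_zero_right, Real.norm_eq_abs, abs_of_pos ht0]
      exact (min_le_left _ _).trans_lt (by linarith))
    have h7 : ‖Complex.exp (-(V * t ^ 2 / 2) + Complex.I * c * t ^ 3)‖ =
        Real.exp (-(V * t ^ 2 / 2)) := norm_cexp_gauss V c t
    have h8 : ‖lam t * Complex.exp (-(Complex.I * A * t))‖ ≤ 1 := by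
      rw [norm_mul, norm_cexp_neg_I_mul, mul_one]
      exact h6
    have h9 := norm_sub_norm_le (Complex.exp (-(V * t ^ 2 / 2) + Complex.I * c * t ^ 3))
      (lam t * Complex.exp (-(Complex.I * A * t)))
    rw [norm_sub_rev, h7] at h9
    have h10 := Real.add_one_le_exp (-(V * t ^ 2 / 2))
    rw [norm_pow, Real.norm_eq_abs, abs_of_pos ht0] at h5
    have h11 : t ^ 3 ≤ t ^ 2 := by nlinarith [sq_nonneg t]
    nlinarith [mul_pos (neg_pos.2 hneg) (pow_pos ht0 2), mul_pos (neg_pos.2 hneg) (pow_pos ht0 3)]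
  exact ⟨A, c, ⟨V, hV0⟩, h2⟩

theorem exists_linear_expansion {g : ℝ → ℂ} (hg : ContDiffAt ℝ 3 g 0) (h0 : g 0 = 1)
    (hsym : ∀ᶠ t in 𝓝 (0 : ℝ), g (-t) = (starRingEnd ℂ) (g t)) :
    ∃ b : ℝ, (fun t : ℝ => g t - (1 + Complex.I * b * t)) =o[𝓝 0] fun t : ℝ => t := by
  obtain ⟨r, hr⟩ := exists_hermitian_taylor_isLittleO (n := 1) (hg.of_le (by norm_num)) hsym
  have hr0 : r 0 = 1 := by
    have h1 := (hr.def one_pos).self_of_nhds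
    simp [Finset.sum_range_succ, h0, sub_eq_zero] at h1
    exact_mod_cast h1.symm
  refine ⟨r 1, (hr.congr_left fun t => ?_).congr_right fun t => by simp⟩
  simp [Finset.sum_range_succ, hr0]; ring

end TaylorExpansion

/-! ### Properties of the eigenvalue forced by characteristic functions -/

section LeadingEigenvalue

theorem norm_le_one_of_norm_pow_mul_le {z w : ℂ} {M : ℝ} (hw : w ≠ 0)
    (h : ∀ N : ℕ, 1 ≤ N → ‖z ^ N * w‖ ≤ M) : ‖z‖ ≤ 1 := by
  by_contra hcon
  push Not at hcon
  have hw' : 0 < ‖w‖ := norm_pos_iff.2 hw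
  obtain ⟨N, hN, hN1⟩ := (((tendsto_pow_atTop_atTop_of_one_lt hcon).eventually_gt_atTop
    (M / ‖w‖)).and (eventually_ge_atTop 1)).exists
  have := h N hN1
  rw [norm_mul, norm_pow, ← le_div_iff₀ hw'] at this
  linarith

/-- Two nonzero geometric sequences that differ by an exponentially smaller term agree. -/
theorem eq_of_norm_pow_mul_sub_le {z z' w w' : ℂ} {M ρ : ℝ} (hz : ρ < ‖z‖) (hρ : 0 < ρ)
    (hw : w ≠ 0) (hw' : w' ≠ 0)
    (h : ∀ N : ℕ, 1 ≤ N → ‖z ^ N * w - z' ^ N * w'‖ ≤ M * ρ ^ N) : z' = z ∧ w' = w := by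
  have hz0 : z ≠ 0 := norm_pos_iff.1 (hρ.trans hz)
  have hzn : 0 < ‖z‖ := hρ.trans hz
  have h1 : Tendsto (fun N : ℕ => M * (ρ / ‖z‖) ^ N) atTop (𝓝 0) := by
    simpa using (tendsto_pow_atTop_nhds_zero_of_lt_one (by positivity)
      ((div_lt_one hzn).2 hz)).const_mul M
  have h2 : Tendsto (fun N : ℕ => w - (z' / z) ^ N * w') atTop (𝓝 0) := by
    refine squeeze_zero_norm' ?_ h1
    filter_upwards [eventually_ge_atTop 1] with N hN
    have h3 : w - (z' / z) ^ N * w' = (z ^ N * w - z' ^ N * w') / z ^ N := by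
      rw [div_pow]; field_simp
    rw [h3, norm_div, norm_pow, div_pow, ← mul_div_assoc]
    gcongr
    exact h N hN
  have h4 : Tendsto (fun N : ℕ => (z' / z) ^ N) atTop (𝓝 (w / w')) := by
    have := (h2.const_sub w).div_const w'
    rw [sub_zero] at this
    refine this.congr fun N => ?_
    rw [sub_sub_cancel]; field_simp
  -- The powers of `z'/z` converge to a nonzero limit, which is invariant under multiplication by
  -- `z'/z`; so this ratio is `1`.
  have h5 : w / w' * (z' / z) = w / w' := by
    refine tendsto_nhds_unique (h4.mul_const (z' / z)) ?_
    have := (tendsto_add_atTop_iff_nat 1).2 h4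
    simpa only [pow_succ] using this
  have h6 : z' / z = 1 := by
    have : w / w' ≠ 0 := div_ne_zero hw hw'
    exact mul_left_cancel₀ this (by rw [h5, mul_one])
  have h7 : w / w' = 1 := by
    refine tendsto_nhds_unique h4 ?_
    simp [h6]
  exact ⟨(div_eq_one_iff_eq hz0).1 h6, ((div_eq_one_iff_eq hw').1 h7).symm⟩

variable {ψ : ℕ → ℝ → ℂ} {lam g : ℝ → ℂ} {δ C ρ : ℝ}

theorem apply_zero_eq_one (hψ0 : ∀ N : ℕ, 1 ≤ N → ψ N 0 = 1) (h0 : lam 0 = 1) (hδ : 0 < δ)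
    (hρ : 0 < ρ) (hρ1 : ρ < 1)
    (h : ∀ N : ℕ, 1 ≤ N → ∀ t : ℝ, |t| ≤ δ → ‖ψ N t - lam t ^ N * g t‖ ≤ C * ρ ^ N) :
    g 0 = 1 := by
  have h1 : Tendsto (fun N : ℕ => C * ρ ^ N) atTop (𝓝 0) := by
    simpa using (tendsto_pow_atTop_nhds_zero_of_lt_one hρ.le hρ1).const_mul C
  have h2 : Tendsto (fun _ : ℕ => 1 - g 0) atTop (𝓝 0) := by
    refine squeeze_zero_norm' ?_ h1
    filter_upwards [eventually_ge_atTop 1] with N hN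
    have := h N hN 0 (by simpa using hδ.le)
    rwa [hψ0 N hN, h0, one_pow, one_mul] at this
  exact (sub_eq_zero.1 (tendsto_nhds_unique tendsto_const_nhds h2)).symm

/-- `lam ^ N * g` follows a bounded Hermitian sequence up to an error of smaller exponential order
than `‖lam t‖ ^ N`. Boundedness forces `‖lam t‖ ≤ 1`, and uniqueness of the leading geometric term
transfers the symmetry to `lam` and `g` separately. -/
theorem eventually_eigenvalue_properties (hψ1 : ∀ N : ℕ, 1 ≤ N → ∀ t, ‖ψ N t‖ ≤ 1)
    (hψc : ∀ N : ℕ, 1 ≤ N → ∀ t, ψ N (-t) = (starRingEnd ℂ) (ψ N t))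
    (hlamc : ContinuousAt lam 0) (hgc : ContinuousAt g 0) (h0 : lam 0 = 1) (hg0 : g 0 = 1)
    (hδ : 0 < δ) (hC : 0 < C) (hρ : 0 < ρ) (hρ1 : ρ < 1)
    (h : ∀ N : ℕ, 1 ≤ N → ∀ t : ℝ, |t| ≤ δ → ‖ψ N t - lam t ^ N * g t‖ ≤ C * ρ ^ N) :
    ∀ᶠ t in 𝓝 (0 : ℝ), ‖lam t‖ ≤ 1 ∧ lam (-t) = (starRingEnd ℂ) (lam t) ∧
      g (-t) = (starRingEnd ℂ) (g t) := by
  have e1 : ∀ᶠ t in 𝓝 (0 : ℝ), ρ < ‖lam t‖ := by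
    have := hlamc.norm.tendsto
    rw [h0, norm_one] at this
    exact this.eventually_const_lt hρ1
  have e2 : ∀ᶠ t in 𝓝 (0 : ℝ), g t ≠ 0 := hgc.eventually_ne (by rw [hg0]; exact one_ne_zero)
  have e3 : ∀ᶠ t in 𝓝 (0 : ℝ), |t| ≤ δ := by
    filter_upwards [Metric.closedBall_mem_nhds (0 : ℝ) hδ] with t ht
    simpa using ht
  have hneg : Tendsto (fun t : ℝ => -t) (𝓝 0) (𝓝 0) := by
    simpa using (continuous_neg (G := ℝ)).tendsto 0
  filter_upwards [e1, e2, e3, hneg.eventually e2] with t h1 h2 h3 h4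
  constructor
  · refine norm_le_one_of_norm_pow_mul_le (M := C + 1) h2 fun N hN => ?_
    have h5 := h N hN t h3
    have h6 := hψ1 N hN t
    have h7 : C * ρ ^ N ≤ C := mul_le_of_le_one_right hC.le (pow_le_one₀ hρ.le hρ1.le)
    have h8 := norm_sub_norm_le (lam t ^ N * g t) (ψ N t)
    rw [norm_sub_rev] at h8
    linarith
  · refine eq_of_norm_pow_mul_sub_le (M := 2 * C) (ρ := ρ) (by rwa [Complex.norm_conj]) hρ
      (by simpa using h2) h4 fun N hN => ?_
    have h5 := h N hN t h3
    have h6 := h N hN (-t) (by rwa [abs_neg])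
    rw [← Complex.norm_conj] at h5
    rw [hψc N hN] at h6
    simp only [map_sub, map_mul, map_pow] at h5
    have h7 := norm_sub_le ((starRingEnd ℂ) (ψ N t) - lam (-t) ^ N * g (-t))
      ((starRingEnd ℂ) (ψ N t) - (starRingEnd ℂ) (lam t) ^ N * (starRingEnd ℂ) (g t))
    rw [sub_sub_sub_cancel_left] at h7
    linarith

end LeadingEigenvalue

/-! ### Comparison with the Edgeworth approximation in Fourier space -/

section FourierEstimate

open Asymptotics

theorem norm_cexp_I_mul_sub_one_sub_le (y : ℝ) :
    ‖Complex.exp (Complex.I * y) - 1 - Complex.I * y‖ ≤ 2 * y ^ 2 := by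
  have hn : ‖Complex.I * (y : ℂ)‖ = |y| := by simp
  rcases le_total |y| 1 with h | h
  · have := Complex.norm_exp_sub_one_sub_id_le (x := Complex.I * y) (by rwa [hn])
    rw [hn, sq_abs] at this
    nlinarith [sq_nonneg y]
  · have h1 := Real.norm_exp_I_mul_ofReal_sub_one_le (x := y)
    refine (norm_sub_le _ _).trans ?_
    rw [hn]
    rw [Real.norm_eq_abs] at h1
    nlinarith [sq_abs y]

/-- Half of the Gaussian decay is given up to absorb the cubic error. -/
theorem eventually_norm_le_exp {hf : ℝ → ℂ} {V c : ℝ} (hV : 0 < V)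
    (h : (fun t : ℝ => hf t - Complex.exp (-(V * t ^ 2 / 2) + Complex.I * c * t ^ 3))
      =o[𝓝 0] fun t : ℝ => t ^ 3) :
    ∀ᶠ t in 𝓝 (0 : ℝ), ‖hf t‖ ≤ Real.exp (-(V * t ^ 2 / 4)) := by
  have e1 : ∀ᶠ t : ℝ in 𝓝 0, Real.exp (-(V * t ^ 2 / 2)) > 1 / 2 := by
    have : Continuous fun t : ℝ => Real.exp (-(V * t ^ 2 / 2)) := by fun_prop
    refine this.continuousAt.eventually_const_lt ?_
    norm_num
  filter_upwards [h.def (show 0 < V / 8 by positivity), e1,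
    Metric.closedBall_mem_nhds (0 : ℝ) one_pos] with t h1 h2 h3
  have h3' : |t| ≤ 1 := by simpa using h3
  have h4 := norm_sub_norm_le (hf t) (Complex.exp (-(V * t ^ 2 / 2) + Complex.I * c * t ^ 3))
  rw [norm_cexp_gauss] at h4
  have h5 : ‖t ^ 3‖ ≤ t ^ 2 := by
    rw [norm_pow, Real.norm_eq_abs, ← sq_abs t]
    exact pow_le_pow_of_le_one (abs_nonneg t) h3' (by norm_num)
  have h6 : Real.exp (-(V * t ^ 2 / 4)) =
      Real.exp (-(V * t ^ 2 / 2)) * Real.exp (V * t ^ 2 / 4) := by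
    rw [← Real.exp_add]; ring_nf
  have h7 := Real.add_one_le_exp (V * t ^ 2 / 4)
  have h8 : 0 ≤ V * t ^ 2 := by positivity
  have h9 : V / 8 * ‖t ^ 3‖ ≤ V / 8 * t ^ 2 := by gcongr
  rw [h6]
  nlinarith

/-- Comparison of the leading term `λ ^ N γ` and of the Edgeworth approximation. -/
theorem norm_sub_edgeworth_le_of_small {V b c ε R t : ℝ} {N : ℕ} {z γ u p : ℂ} (hV : 0 < V)
    (hε : 0 < ε) (hN : 2 ≤ N) (ht : 0 < t) (hu : ‖u‖ = 1)
    (h1 : ‖z * u - Complex.exp (-(V * t ^ 2 / 2) + Complex.I * c * t ^ 3)‖ ≤ ε * t ^ 3)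
    (h2 : ‖z * u‖ ≤ Real.exp (-(V * t ^ 2 / 4))) (h3 : ‖γ - (1 + Complex.I * b * t)‖ ≤ ε * t)
    (h4 : ‖γ‖ ≤ 2) (h5 : ‖p - z ^ N * γ‖ ≤ R) :
    ‖p * u ^ N - Complex.exp (-(V * (N * t ^ 2) / 2)) *
      (1 + Complex.I * (b * t + c * (N * t ^ 3)))‖ ≤
      Real.exp (-(V * (N * t ^ 2) / 8)) * (2 * ε * (N * t ^ 3) + ε * t +
        (2 * (c * (N * t ^ 3)) ^ 2 + |b * c| * (t * (N * t ^ 3)))) + R := by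
  set β : ℂ := Complex.exp (-(V * t ^ 2 / 2) + Complex.I * c * t ^ 3) with hβ
  set E : ℂ := Complex.exp (-(V * (N * t ^ 2) / 2)) with hE
  set y : ℝ := c * (N * t ^ 3) with hy
  set E8 := Real.exp (-(V * (N * t ^ 2) / 8)) with hE8
  have hN' : (2 : ℝ) ≤ N := by exact_mod_cast hN
  have hq : 0 ≤ V * t ^ 2 := by positivity
  have hβN : β ^ N = E * Complex.exp (Complex.I * y) := by
    rw [hβ, hE, ← Complex.exp_nat_mul, ← Complex.exp_add]
    congr 1; simp only [hy]; push_cast; ring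
  have hEn : ‖E‖ ≤ E8 := by
    rw [hE, hE8, Complex.norm_exp]
    gcongr
    rw [show (-(V * (N * t ^ 2) / 2) : ℂ) = ((-(V * (N * t ^ 2) / 2) : ℝ) : ℂ) by push_cast; ring,
      Complex.ofReal_re]
    nlinarith [mul_nonneg hq (by linarith : (0 : ℝ) ≤ N)]
  have hei : ‖Complex.exp (Complex.I * y)‖ = 1 := by
    rw [mul_comm]; exact Complex.norm_exp_ofReal_mul_I _
  have hr0 : 0 < Real.exp (-(V * t ^ 2 / 4)) := Real.exp_pos _
  have hβn : ‖β‖ ≤ Real.exp (-(V * t ^ 2 / 4)) := by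
    rw [hβ, norm_cexp_gauss]
    exact Real.exp_le_exp.2 (by linarith)
  have hpow : ∀ {x : ℂ}, ‖x‖ ≤ Real.exp (-(V * t ^ 2 / 4)) → ∀ m : ℕ, ‖x ^ m‖ ≤
      1 * Real.exp (-(V * t ^ 2 / 4)) ^ m := fun hx m => by
    rw [one_mul, norm_pow]; gcongr
  have k1 : ‖((z * u) ^ N - β ^ N) * γ‖ ≤ E8 * (2 * ε * (N * t ^ 3)) := by
    have h6 := norm_pow_sub_pow_le one_pos hr0 (hpow h2) (hpow hβn) N
    -- Telescoping leaves `N - 1` Gaussian factors; `N ≥ 2` gives `N - 1 ≥ N/2`, which turns the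
    -- rate `V/4` into `V/8`.
    have h7 : 1 ^ 2 / Real.exp (-(V * t ^ 2 / 4)) * (N * Real.exp (-(V * t ^ 2 / 4)) ^ N) ≤
        N * E8 := by
      have : 1 ^ 2 / Real.exp (-(V * t ^ 2 / 4)) * (N * Real.exp (-(V * t ^ 2 / 4)) ^ N) =
          N * Real.exp (V * t ^ 2 / 4 + N * (-(V * t ^ 2 / 4))) := by
        rw [Real.exp_add, Real.exp_nat_mul, one_pow, one_div, ← Real.exp_neg, neg_neg]; ring
      rw [this, hE8]
      gcongr
      nlinarith
    rw [norm_mul]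
    calc _ ≤ (N * E8 * (ε * t ^ 3)) * 2 := by
          gcongr
          exact h6.trans (by gcongr)
      _ = _ := by ring
  have k2 : ‖β ^ N * (γ - (1 + Complex.I * b * t))‖ ≤ E8 * (ε * t) := by
    rw [hβN, norm_mul, norm_mul, hei, mul_one]
    gcongr
  have k3 : ‖E * ((Complex.exp (Complex.I * y) - 1 - Complex.I * y) +
      (Complex.exp (Complex.I * y) - 1) * (Complex.I * b * t))‖ ≤
      E8 * (2 * (c * (N * t ^ 3)) ^ 2 + |b * c| * (t * (N * t ^ 3))) := by
    rw [norm_mul]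
    gcongr
    refine (norm_add_le _ _).trans (add_le_add (norm_cexp_I_mul_sub_one_sub_le y) ?_)
    rw [norm_mul, norm_mul, norm_mul, Complex.norm_I, one_mul, Complex.norm_real,
      Complex.norm_real, Real.norm_eq_abs, Real.norm_eq_abs, abs_of_pos ht]
    have h8 := Real.norm_exp_I_mul_ofReal_sub_one_le (x := y)
    rw [Real.norm_eq_abs, hy, abs_mul, abs_of_nonneg (by positivity : (0 : ℝ) ≤ N * t ^ 3)] at h8
    calc _ ≤ (|c| * (N * t ^ 3)) * (|b| * t) := by gcongr
      _ = _ := by rw [abs_mul]; ring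
  have k4 : ‖(p - z ^ N * γ) * u ^ N‖ ≤ R := by
    rw [norm_mul, norm_pow, hu, one_pow, mul_one]; exact h5
  -- Four errors: replacing the eigenvalue by `β`, linearizing the amplitude, linearizing `e^{iy}`
  -- together with the cross term, and the spectral remainder.
  have hsplit : p * u ^ N - E * (1 + Complex.I * (b * t + c * (N * t ^ 3))) =
      ((z * u) ^ N - β ^ N) * γ + β ^ N * (γ - (1 + Complex.I * b * t)) +
      E * ((Complex.exp (Complex.I * y) - 1 - Complex.I * y) +
      (Complex.exp (Complex.I * y) - 1) * (Complex.I * b * t)) + (p - z ^ N * γ) * u ^ N := by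
    rw [hβN, mul_pow]; simp only [hy]; push_cast; ring
  rw [hsplit]
  calc _ ≤ _ := norm_add₄_le
    _ ≤ E8 * (2 * ε * (N * t ^ 3)) + E8 * (ε * t) +
      E8 * (2 * (c * (N * t ^ 3)) ^ 2 + |b * c| * (t * (N * t ^ 3))) + R := by gcongr
    _ = _ := by ring

/-- The weight `(1 + τ²)³ e^{-Vτ²/8}` that dominates all Gaussian terms. -/
def gaussWeight (V τ : ℝ) : ℝ := (1 + τ ^ 2) ^ 3 * Real.exp (-(V * τ ^ 2 / 8))

theorem integrable_gaussWeight {V : ℝ} (hV : 0 < V) : Integrable (gaussWeight V) := by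
  have h1 : ∀ n : ℕ, Integrable fun x : ℝ => x ^ n * Real.exp (-(V / 8) * x ^ 2) := fun n => by
    have := integrable_rpow_mul_exp_neg_mul_sq (b := V / 8) (by positivity)
      (s := n) (by have : (0 : ℝ) ≤ n := by positivity
                   linarith)
    simpa only [Real.rpow_natCast] using this
  have h2 : gaussWeight V = fun x => ((x ^ 0 * Real.exp (-(V / 8) * x ^ 2) +
      3 * (x ^ 2 * Real.exp (-(V / 8) * x ^ 2))) + 3 * (x ^ 4 * Real.exp (-(V / 8) * x ^ 2))) +
      x ^ 6 * Real.exp (-(V / 8) * x ^ 2) := by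
    ext x
    rw [gaussWeight, show -(V * x ^ 2 / 8) = -(V / 8) * x ^ 2 by ring]; ring
  rw [h2]
  exact (((h1 0).add ((h1 2).const_mul 3)).add ((h1 4).const_mul 3)).add (h1 6)

end FourierEstimate

section FourierEstimate

open Asymptotics

theorem one_le_add_sq_pow (τ : ℝ) : 1 ≤ (1 + τ ^ 2) ^ 3 :=
  one_le_pow₀ (by nlinarith [sq_nonneg τ])

/-- Estimate near the origin, at frequency `τ / √N` with `τ / √N` small. -/
theorem norm_sub_edgeworth_le_near {V b c ε D τ ρ : ℝ} {N : ℕ} {z γ u p : ℂ} (hV : 0 < V)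
    (hε : 0 < ε) (hN : 2 ≤ N) (hτ : 0 < τ) (hu : ‖u‖ = 1)
    (h1 : ‖z * u - Complex.exp (-(V * ((τ / √N : ℝ) : ℂ) ^ 2 / 2) +
      Complex.I * c * ((τ / √N : ℝ) : ℂ) ^ 3)‖ ≤ ε * (τ / √N) ^ 3)
    (h2 : ‖z * u‖ ≤ Real.exp (-(V * (τ / √N) ^ 2 / 4)))
    (h3 : ‖γ - (1 + Complex.I * b * ((τ / √N : ℝ) : ℂ))‖ ≤ ε * (τ / √N))
    (h4 : ‖γ‖ ≤ 2) (h5 : ‖p - z ^ N * γ‖ ≤ D * (τ / √N) * ρ ^ N) :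
    ‖p * u ^ N - Complex.exp (-(V * τ ^ 2 / 2)) *
      (1 + Complex.I * (b * τ + c * τ ^ 3) / (√N : ℝ))‖ ≤
      τ * (gaussWeight V τ * (2 * ε / √N + (2 * c ^ 2 + |b * c|) / N) + D * ρ ^ N / √N) := by
  have hN0 : (0 : ℝ) < N := by have : (2 : ℝ) ≤ N := by exact_mod_cast hN
                               linarith
  have hs : 0 < √(N : ℝ) := Real.sqrt_pos.2 hN0
  have hsq : √(N : ℝ) ^ 2 = N := Real.sq_sqrt hN0.le
  have hmain := norm_sub_edgeworth_le_of_small hV hε hN (div_pos hτ hs) hu h1 h2 h3 h4 h5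
  have e1 : (N : ℝ) * (τ / √N) ^ 2 = τ ^ 2 := by rw [div_pow, hsq]; field_simp
  have e2 : (N : ℝ) * (τ / √N) ^ 3 = τ ^ 3 / √N := by
    rw [pow_succ, ← mul_assoc, e1]; ring
  have c1 : (N : ℂ) * ((τ / √N : ℝ) : ℂ) ^ 2 = (τ : ℂ) ^ 2 := by exact_mod_cast e1
  have c2 : (N : ℂ) * ((τ / √N : ℝ) : ℂ) ^ 3 = (τ : ℂ) ^ 3 / (√N : ℝ) := by exact_mod_cast e2
  rw [e1, e2, c1, c2] at hmain
  have e3 : (1 : ℂ) + Complex.I * (b * τ + c * τ ^ 3) / (√N : ℝ) =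
      1 + Complex.I * (b * ((τ / √N : ℝ) : ℂ) + c * (τ ^ 3 / (√N : ℝ))) := by
    push_cast; ring
  rw [e3]
  refine hmain.trans ?_
  have e4 : 2 * ε * (τ ^ 3 / √N) + ε * (τ / √N) + (2 * (c * (τ ^ 3 / √N)) ^ 2 +
      |b * c| * (τ / √N * (τ ^ 3 / √N))) = τ * (ε / √N * (2 * τ ^ 2 + 1) +
        1 / N * (2 * c ^ 2 * τ ^ 5 + |b * c| * τ ^ 3)) := by
    have : (2 * (c * (τ ^ 3 / √N)) ^ 2 + |b * c| * (τ / √N * (τ ^ 3 / √N))) =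
        (2 * (c * τ ^ 3) ^ 2 + |b * c| * τ ^ 4) / √(N : ℝ) ^ 2 := by field_simp
    rw [this, hsq]; field_simp
  rw [e4, gaussWeight]
  have p1 : 2 * τ ^ 2 + 1 ≤ 2 * (1 + τ ^ 2) ^ 3 := by
    nlinarith [pow_nonneg hτ.le 2, pow_nonneg hτ.le 4, pow_nonneg hτ.le 6]
  have p2 : τ ^ 5 ≤ (1 + τ ^ 2) ^ 3 := by
    nlinarith [pow_nonneg hτ.le 2, pow_nonneg hτ.le 4, pow_nonneg hτ.le 6,
      mul_nonneg (pow_nonneg hτ.le 4) (sq_nonneg (τ - 1))]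
  have p3 : τ ^ 3 ≤ (1 + τ ^ 2) ^ 3 := by
    nlinarith [pow_nonneg hτ.le 2, pow_nonneg hτ.le 4, pow_nonneg hτ.le 6,
      mul_nonneg (pow_nonneg hτ.le 2) (sq_nonneg (τ - 1))]
  have p4 : ε / √N * (2 * τ ^ 2 + 1) + 1 / N * (2 * c ^ 2 * τ ^ 5 + |b * c| * τ ^ 3) ≤
      (1 + τ ^ 2) ^ 3 * (2 * ε / √N + (2 * c ^ 2 + |b * c|) / N) := by
    calc _ ≤ ε / √N * (2 * (1 + τ ^ 2) ^ 3) +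
          1 / N * (2 * c ^ 2 * (1 + τ ^ 2) ^ 3 + |b * c| * (1 + τ ^ 2) ^ 3) := by gcongr
      _ = _ := by ring
  calc _ ≤ Real.exp (-(V * τ ^ 2 / 8)) * (τ * ((1 + τ ^ 2) ^ 3 *
        (2 * ε / √N + (2 * c ^ 2 + |b * c|) / N))) + D * (τ / √N) * ρ ^ N := by gcongr
    _ = _ := by ring

/-- Estimate away from the origin, at frequency `τ / √N ≥ δ`. -/
theorem norm_sub_edgeworth_le_far {V b c D τ δ r : ℝ} {N : ℕ} {u p : ℂ} (hV : 0 < V)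
    (hδ : 0 < δ) (hN : 1 ≤ N) (hr : 0 < r) (hD : 0 < D) (hτ : δ ≤ τ / √N) (hu : ‖u‖ = 1)
    (h5 : ‖p‖ ≤ D * r ^ N) :
    ‖p * u ^ N - Complex.exp (-(V * τ ^ 2 / 2)) *
      (1 + Complex.I * (b * τ + c * τ ^ 3) / (√N : ℝ))‖ ≤
      τ * (gaussWeight V τ * ((1 / δ + |b| + |c|) * Real.exp (-(V * δ ^ 2 / 4)) ^ N) +
        D * r ^ N / δ) := by
  have hN1 : (1 : ℝ) ≤ N := by exact_mod_cast hN
  have hs1 : 1 ≤ √(N : ℝ) := Real.one_le_sqrt.2 hN1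
  have hs : 0 < √(N : ℝ) := by linarith
  have hsq : √(N : ℝ) ^ 2 = N := Real.sq_sqrt (by linarith)
  have hτs : δ * √N ≤ τ := (le_div_iff₀ hs).1 hτ
  have hτδ : δ ≤ τ := by nlinarith
  have hτ0 : 0 < τ := hδ.trans_le hτδ
  have k1 : ‖p * u ^ N‖ ≤ τ * (D * r ^ N / δ) := by
    rw [norm_mul, norm_pow, hu, one_pow, mul_one]
    refine h5.trans ?_
    rw [← mul_div_assoc, le_div_iff₀ hδ, mul_comm]
    gcongr
  have hE : ‖Complex.exp (-(V * τ ^ 2 / 2))‖ ≤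
      Real.exp (-(V * τ ^ 2 / 8)) * Real.exp (-(V * δ ^ 2 / 4)) ^ N := by
    rw [show (-(V * τ ^ 2 / 2) : ℂ) = ((-(V * τ ^ 2 / 2) : ℝ) : ℂ) by push_cast; ring,
      Complex.norm_exp, Complex.ofReal_re, ← Real.exp_nat_mul, ← Real.exp_add]
    refine Real.exp_le_exp.2 ?_
    have : δ ^ 2 * N ≤ τ ^ 2 := by
      rw [← hsq, ← mul_pow]; gcongr
    nlinarith [mul_le_mul_of_nonneg_left this hV.le, mul_nonneg hV.le (sq_nonneg τ)]
  have p1 := one_le_add_sq_pow τ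
  have p2 : τ ^ 2 ≤ (1 + τ ^ 2) ^ 3 := by
    nlinarith [pow_nonneg hτ0.le 2, pow_nonneg hτ0.le 4, pow_nonneg hτ0.le 6]
  have k3 : ‖1 + Complex.I * (b * τ + c * τ ^ 3) / (√N : ℝ)‖ ≤
      τ * ((1 + τ ^ 2) ^ 3 * (1 / δ + |b| + |c|)) := by
    have h6 : ‖(b * τ + c * τ ^ 3 : ℂ)‖ ≤ |b| * τ + |c| * τ ^ 3 := by
      refine (norm_add_le _ _).trans (le_of_eq ?_)
      simp [abs_of_pos hτ0]
    have h7 : ‖Complex.I * (b * τ + c * τ ^ 3) / (√N : ℝ)‖ ≤ |b| * τ + |c| * τ ^ 3 := by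
      rw [norm_div, norm_mul, Complex.norm_I, one_mul, Complex.norm_real, Real.norm_eq_abs,
        abs_of_pos hs]
      exact (div_le_self (norm_nonneg _) hs1).trans h6
    have h8 : (1 : ℝ) ≤ τ * (1 / δ) := by rw [mul_one_div, le_div_iff₀ hδ]; linarith
    calc _ ≤ 1 + (|b| * τ + |c| * τ ^ 3) := by
          refine (norm_add_le _ _).trans ?_
          rw [norm_one]; gcongr
      _ ≤ τ * (1 / δ) + (|b| * τ + |c| * τ ^ 3) := by gcongr
      _ = τ * (1 * (1 / δ) + 1 * |b| + τ ^ 2 * |c|) := by ring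
      _ ≤ τ * ((1 + τ ^ 2) ^ 3 * (1 / δ) + (1 + τ ^ 2) ^ 3 * |b| + (1 + τ ^ 2) ^ 3 * |c|) := by
          gcongr
      _ = _ := by ring
  refine (norm_sub_le _ _).trans ?_
  rw [norm_mul (Complex.exp _), gaussWeight]
  calc _ ≤ τ * (D * r ^ N / δ) + (Real.exp (-(V * τ ^ 2 / 8)) *
        Real.exp (-(V * δ ^ 2 / 4)) ^ N) * (τ * ((1 + τ ^ 2) ^ 3 * (1 / δ + |b| + |c|))) :=
        add_le_add k1 (mul_le_mul hE k3 (norm_nonneg _) (by positivity))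
    _ = _ := by ring

theorem tendsto_sqrt_mul_pow {r : ℝ} (h0 : 0 < r) (h1 : r < 1) :
    Tendsto (fun N : ℕ => √(N : ℝ) * r ^ N) atTop (𝓝 0) := by
  refine squeeze_zero (fun N => by positivity) (fun N => ?_)
    (tendsto_self_mul_const_pow_of_abs_lt_one (by rwa [abs_of_pos h0]))
  rcases Nat.eq_zero_or_pos N with rfl | hN
  · simp
  have : (1 : ℝ) ≤ N := by exact_mod_cast hN
  gcongr
  rw [Real.sqrt_le_left (by positivity)]
  nlinarith

theorem tendsto_mul_pow_self {r : ℝ} (h0 : 0 < r) (h1 : r < 1) :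
    Tendsto (fun N : ℕ => (N : ℝ) * r ^ N) atTop (𝓝 0) :=
  tendsto_self_mul_const_pow_of_abs_lt_one (by rwa [abs_of_pos h0])

variable {ψ : ℕ → ℝ → ℂ} {lam g : ℝ → ℂ} {δ₀ D ρ A b c V : ℝ}

/-- The integrated Fourier estimate that enters Esseen's inequality. -/
theorem eventually_fourier_estimate (hV : 0 < V) (hδ₀ : 0 < δ₀) (hD : 0 < D) (hρ : 0 < ρ)
    (hρ1 : ρ < 1)
    (hlam : (fun t : ℝ => lam t * Complex.exp (-(Complex.I * A * t)) -
      Complex.exp (-(V * t ^ 2 / 2) + Complex.I * c * t ^ 3)) =o[𝓝 0] fun t : ℝ => t ^ 3)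
    (hg : (fun t : ℝ => g t - (1 + Complex.I * b * t)) =o[𝓝 0] fun t : ℝ => t)
    (hgc : ContinuousAt g 0) (hg0 : g 0 = 1)
    (hnear : ∀ N : ℕ, 1 ≤ N → ∀ t : ℝ, |t| ≤ δ₀ → ‖ψ N t - lam t ^ N * g t‖ ≤ D * |t| * ρ ^ N)
    (hfar : ∀ δ T : ℝ, 0 < δ → ∃ D r : ℝ, 0 < D ∧ 0 < r ∧ r < 1 ∧ ∀ t : ℝ, δ ≤ |t| → |t| ≤ T →
      ∀ N : ℕ, ‖ψ N t‖ ≤ D * r ^ N) {T η : ℝ} (hT : 0 < T) (hη : 0 < η) :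
    ∀ᶠ N : ℕ in atTop, ∃ β : ℝ → ℝ, IntervalIntegrable β volume 0 (T * √N) ∧
      (∀ τ ∈ Set.Ioc 0 (T * √N), ‖ψ N (τ / √N) *
        Complex.exp (-(Complex.I * A * ((τ / √N : ℝ) : ℂ))) ^ N -
        Complex.exp (-(V * τ ^ 2 / 2)) *
          (1 + Complex.I * (b * τ + c * τ ^ 3) / (√N : ℝ))‖ ≤ τ * β τ) ∧
      ∫ τ in (0 : ℝ)..T * √N, β τ ≤ η / √N := by
  have hwi := integrable_gaussWeight hV
  have hw0 : ∀ τ, 0 ≤ gaussWeight V τ := fun τ => by unfold gaussWeight; positivity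
  set K := ∫ τ, gaussWeight V τ with hK
  have hK0 : 0 ≤ K := integral_nonneg hw0
  -- After multiplication by `√N` the only error that does not vanish is `2εK`; this choice makes it
  -- at most `η/2`.
  set ε := η / (4 * (K + 1)) with hε
  have hε0 : 0 < ε := by positivity
  have e1 := hlam.def hε0
  have e2 := eventually_norm_le_exp hV hlam
  have e3 := hg.def hε0
  have e4 : ∀ᶠ t in 𝓝 (0 : ℝ), ‖g t‖ < 2 := by
    have := hgc.norm.tendsto
    rw [hg0, norm_one] at this
    exact this.eventually_lt_const (by norm_num)
  obtain ⟨δ₁, hδ₁, hball⟩ := Metric.nhds_basis_closedBall.eventually_iff.1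
    (((e1.and e2).and e3).and e4)
  set δ := min δ₀ δ₁ with hδdef
  have hδ : 0 < δ := lt_min hδ₀ hδ₁
  obtain ⟨D', r, hD', hr, hr1, hdec⟩ := hfar δ T hδ
  set q := Real.exp (-(V * δ ^ 2 / 4)) with hq
  have hq0 : 0 < q := Real.exp_pos _
  have hq1 : q < 1 := by rw [hq, Real.exp_lt_one_iff]; have : 0 < V * δ ^ 2 := by positivity
                         linarith
  set M₁ := 2 * c ^ 2 + |b * c| with hM₁
  set M₂ := 1 / δ + |b| + |c| with hM₂
  have hM₁0 : 0 ≤ M₁ := by positivity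
  have hM₂0 : 0 ≤ M₂ := by positivity
  -- the error terms, multiplied by `√N`
  have hlim : Tendsto (fun N : ℕ => K * (M₁ * (√(N : ℝ))⁻¹ + M₂ * (√(N : ℝ) * q ^ N)) +
      T * (D * (√(N : ℝ) * ρ ^ N) + D' / δ * (N * r ^ N))) atTop (𝓝 0) := by
    have l1 : Tendsto (fun N : ℕ => (√(N : ℝ))⁻¹) atTop (𝓝 0) :=
      (Real.tendsto_sqrt_atTop.comp tendsto_natCast_atTop_atTop).inv_tendsto_atTop
    have := (((l1.const_mul M₁).add ((tendsto_sqrt_mul_pow hq0 hq1).const_mul M₂)).const_mul K).add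
      ((((tendsto_sqrt_mul_pow hρ hρ1).const_mul D).add
        ((tendsto_mul_pow_self hr hr1).const_mul (D' / δ))).const_mul T)
    simpa using this
  filter_upwards [eventually_ge_atTop 2, hlim.eventually_lt_const (half_pos hη)] with N hN hsmall
  have hN1 : 1 ≤ N := by omega
  have hN0 : (0 : ℝ) < N := by exact_mod_cast hN1
  have hs : 0 < √(N : ℝ) := Real.sqrt_pos.2 hN0
  have hsq : √(N : ℝ) * √(N : ℝ) = N := Real.mul_self_sqrt hN0.le
  set B := (2 * ε / √N + M₁ / N) + M₂ * q ^ N with hB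
  set G := D * ρ ^ N / √N + D' * r ^ N / δ with hG
  have hB0 : 0 ≤ B := by positivity
  refine ⟨fun τ => gaussWeight V τ * B + G, ?_, ?_, ?_⟩
  · exact ((hwi.mul_const B).intervalIntegrable).add intervalIntegrable_const
  · intro τ hτ
    have ht0 : 0 < τ / √N := div_pos hτ.1 hs
    have hu : ‖Complex.exp (-(Complex.I * A * ((τ / √N : ℝ) : ℂ)))‖ = 1 := norm_cexp_neg_I_mul _ _
    rcases le_total (τ / √N) δ with hcase | hcase
    · obtain ⟨⟨⟨h1, h2⟩, h3⟩, h4⟩ := hball (x := τ / √N) (by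
        rw [mem_closedBall_zero_iff, Real.norm_eq_abs, abs_of_pos ht0]
        exact hcase.trans (min_le_right _ _))
      have h5 := hnear N hN1 (τ / √N) (by
        rw [abs_of_pos ht0]; exact hcase.trans (min_le_left _ _))
      rw [abs_of_pos ht0] at h5
      rw [norm_pow, Real.norm_eq_abs, abs_of_pos ht0] at h1
      rw [Real.norm_eq_abs, abs_of_pos ht0] at h3
      refine (norm_sub_edgeworth_le_near hV hε0 hN hτ.1 hu h1 h2 h3 h4.le h5).trans ?_
      have hw := hw0 τ
      have := hτ.1
      have hz1 : 0 ≤ M₂ * q ^ N := by positivity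
      have hz2 : 0 ≤ D' * r ^ N / δ := by positivity
      have hx1 : 2 * ε / √N + M₁ / N ≤ B := by linarith
      have hx2 : D * ρ ^ N / √N ≤ G := by linarith
      change _ ≤ τ * (gaussWeight V τ * B + G)
      gcongr τ * (gaussWeight V τ * ?_ + ?_)
    · have h5 := hdec (τ / √N) (by rwa [abs_of_pos ht0]) (by
        rw [abs_of_pos ht0, div_le_iff₀ hs]; exact hτ.2) N
      refine (norm_sub_edgeworth_le_far (b := b) (c := c) hV hδ hN1 hr hD' hcase hu h5).trans ?_
      have hw := hw0 τ
      have := hτ.1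
      have hz1 : 0 ≤ 2 * ε / √N + M₁ / N := by positivity
      have hz2 : 0 ≤ D * ρ ^ N / √N := by positivity
      have hx1 : M₂ * q ^ N ≤ B := by linarith
      have hx2 : D' * r ^ N / δ ≤ G := by linarith
      change _ ≤ τ * (gaussWeight V τ * B + G)
      gcongr τ * (gaussWeight V τ * ?_ + ?_)
  · have hTs : 0 ≤ T * √N := by positivity
    have hI : ∫ τ in (0 : ℝ)..T * √N, gaussWeight V τ ≤ K := by
      rw [intervalIntegral.integral_of_le hTs]
      exact setIntegral_le_integral hwi (ae_of_all _ hw0)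
    rw [intervalIntegral.integral_add (hwi.mul_const B).intervalIntegrable
      intervalIntegrable_const, intervalIntegral.integral_mul_const,
      intervalIntegral.integral_const, sub_zero, smul_eq_mul]
    have hKε : K * (2 * ε) ≤ η / 2 := by
      rw [hε, ← mul_div_assoc, ← mul_div_assoc, div_le_iff₀ (by positivity)]
      nlinarith
    rw [le_div_iff₀ hs]
    calc _ ≤ (K * B + T * √N * G) * √N := by gcongr
      _ = K * (2 * ε) + (K * (M₁ * (√(N : ℝ))⁻¹ + M₂ * (√(N : ℝ) * q ^ N)) +
          T * (D * (√(N : ℝ) * ρ ^ N) + D' / δ * (N * r ^ N))) := by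
        simp only [hB, hG]
        have hd : M₁ / N * √(N : ℝ) = M₁ * (√(N : ℝ))⁻¹ := by
          have : (√(N : ℝ))⁻¹ * N = √N := by rw [inv_mul_eq_iff_eq_mul₀ hs.ne', hsq]
          rw [div_mul_eq_mul_div, div_eq_iff hN0.ne', mul_assoc, this]
        have hd1 : 2 * ε / √(N : ℝ) * √N = 2 * ε := div_mul_cancel₀ _ hs.ne'
        have hd2 : D * ρ ^ N / √(N : ℝ) * √N = D * ρ ^ N := div_mul_cancel₀ _ hs.ne'
        linear_combination K * hd + K * hd1 + T * √(N : ℝ) * hd2 + T * D' * r ^ N / δ * hsq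
      _ ≤ η := by linarith

end FourierEstimate

/-! ### Characteristic functions of the sums -/

section CharFun

variable {Ω : Type*} [MeasurableSpace Ω] {P : Measure Ω} {X : ℕ → Ω → ℝ}

theorem aemeasurable_partialSum (hX : ∀ n, 1 ≤ n → AEMeasurable (X n) P) (N : ℕ) :
    AEMeasurable (partialSum X N) P := by
  unfold partialSum
  exact Finset.aemeasurable_fun_sum _ fun n hn => hX n (Finset.mem_Icc.1 hn).1

theorem aemeasurable_normalizedSum (hX : ∀ n, 1 ≤ n → AEMeasurable (X n) P) (A : ℝ) (N : ℕ) :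
    AEMeasurable (normalizedSum X A N) P := by
  unfold normalizedSum
  exact ((aemeasurable_partialSum hX N).sub_const _).div_const _

theorem norm_cexp_I_mul_mul (t x : ℝ) : ‖Complex.exp (Complex.I * t * x)‖ = 1 := by
  rw [show Complex.I * t * x = ((t * x : ℝ) : ℂ) * Complex.I by push_cast; ring]
  exact Complex.norm_exp_ofReal_mul_I _

theorem norm_integral_cexp_le_one [IsProbabilityMeasure P] (Y : Ω → ℝ) (t : ℝ) :
    ‖∫ ω, Complex.exp (Complex.I * t * Y ω) ∂P‖ ≤ 1 := by
  refine (norm_integral_le_integral_norm _).trans ?_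
  simp [norm_cexp_I_mul_mul]

theorem integral_cexp_neg (Y : Ω → ℝ) (t : ℝ) :
    ∫ ω, Complex.exp (Complex.I * (-t : ℝ) * Y ω) ∂P =
      (starRingEnd ℂ) (∫ ω, Complex.exp (Complex.I * t * Y ω) ∂P) := by
  rw [← integral_conj]
  congr 1; ext ω
  rw [← Complex.exp_conj]
  simp

/-- The characteristic function of the normalized sum. -/
theorem fourier_map_normalizedSum (hX : ∀ n, 1 ≤ n → AEMeasurable (X n) P) (A : ℝ) {N : ℕ}
    (hN : 1 ≤ N) (τ : ℝ) :
    ∫ w : ℝ, Complex.exp (Complex.I * τ * w) ∂(P.map (normalizedSum X A N)) =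
      (∫ ω, Complex.exp (Complex.I * (τ / √N : ℝ) * partialSum X N ω) ∂P) *
        Complex.exp (-(Complex.I * A * ((τ / √N : ℝ) : ℂ))) ^ N := by
  have hN0 : (0 : ℝ) < N := by exact_mod_cast hN
  have hs : ((√(N : ℝ) : ℝ) : ℂ) ≠ 0 := by exact_mod_cast (Real.sqrt_pos.2 hN0).ne'
  rw [integral_map (aemeasurable_normalizedSum hX A N) (by fun_prop), ← integral_mul_const]
  congr 1; ext ω
  rw [← Complex.exp_nat_mul, ← Complex.exp_add, normalizedSum]
  congr 1
  push_cast
  field_simp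
  ring

end CharFun

/-! ### Pointwise limit of the characteristic functions -/

section Limit

open Asymptotics

variable {ψ : ℕ → ℝ → ℂ} {lam g : ℝ → ℂ} {δ C ρ A c V : ℝ}

/-- Covers `V = 0` too: no Gaussian decay is used, only that both bases have modulus at most one.
Telescoping then costs `N · (|τ|/√N)³ = |τ|³/√N`. -/
theorem tendsto_mul_cexp_pow (hV : 0 ≤ V) (hδ : 0 < δ) (hρ : 0 < ρ) (hρ1 : ρ < 1)
    (hle : ∀ᶠ t in 𝓝 (0 : ℝ), ‖lam t‖ ≤ 1)
    (hlam : (fun t : ℝ => lam t * Complex.exp (-(Complex.I * A * t)) -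
      Complex.exp (-(V * t ^ 2 / 2) + Complex.I * c * t ^ 3)) =o[𝓝 0] fun t : ℝ => t ^ 3)
    (hgc : ContinuousAt g 0) (hg0 : g 0 = 1)
    (h : ∀ N : ℕ, 1 ≤ N → ∀ t : ℝ, |t| ≤ δ → ‖ψ N t - lam t ^ N * g t‖ ≤ C * ρ ^ N) (τ : ℝ) :
    Tendsto (fun N : ℕ => ψ N (τ / √N) *
      Complex.exp (-(Complex.I * A * ((τ / √N : ℝ) : ℂ))) ^ N) atTop
      (𝓝 (Complex.exp (-(V * τ ^ 2 / 2)))) := by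
  have hinv : Tendsto (fun N : ℕ => (√(N : ℝ))⁻¹) atTop (𝓝 0) :=
    (Real.tendsto_sqrt_atTop.comp tendsto_natCast_atTop_atTop).inv_tendsto_atTop
  have ht : Tendsto (fun N : ℕ => τ / √(N : ℝ)) atTop (𝓝 0) := by
    simpa [div_eq_mul_inv] using hinv.const_mul τ
  set u : ℕ → ℂ := fun N => Complex.exp (-(Complex.I * A * ((τ / √N : ℝ) : ℂ))) with hu
  have hu1 : ∀ N, ‖u N‖ = 1 := fun N => norm_cexp_neg_I_mul _ _
  set w : ℕ → ℂ := fun N => Complex.exp (-(V * ((τ / √N : ℝ) : ℂ) ^ 2 / 2) +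
    Complex.I * c * ((τ / √N : ℝ) : ℂ) ^ 3) with hw
  have l1 : Tendsto (fun N : ℕ => ψ N (τ / √N) * u N ^ N -
      (lam (τ / √N) * u N) ^ N * g (τ / √N)) atTop (𝓝 0) := by
    have h1 : Tendsto (fun N : ℕ => C * ρ ^ N) atTop (𝓝 0) := by
      simpa using (tendsto_pow_atTop_nhds_zero_of_lt_one hρ.le hρ1).const_mul C
    refine squeeze_zero_norm' ?_ h1
    have hsm : ∀ᶠ N : ℕ in atTop, |τ / √(N : ℝ)| ≤ δ := by
      have := ht.abs
      rw [abs_zero] at this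
      exact (this.eventually_lt_const hδ).mono fun _ => le_of_lt
    filter_upwards [eventually_ge_atTop 1, hsm] with N hN hN'
    rw [show ψ N (τ / √N) * u N ^ N - (lam (τ / √N) * u N) ^ N * g (τ / √N) =
      (ψ N (τ / √N) - lam (τ / √N) ^ N * g (τ / √N)) * u N ^ N by ring, norm_mul, norm_pow, hu1,
      one_pow, mul_one]
    exact h N hN _ hN'
  have l2 : Tendsto (fun N : ℕ => (lam (τ / √N) * u N) ^ N - w N ^ N) atTop (𝓝 0) := by
    have h1 : Tendsto (fun N : ℕ => |τ| ^ 3 * (√(N : ℝ))⁻¹) atTop (𝓝 0) := by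
      simpa using hinv.const_mul (|τ| ^ 3)
    refine squeeze_zero_norm' ?_ h1
    filter_upwards [eventually_ge_atTop 1, ht.eventually hle, ht.eventually (hlam.def one_pos)]
      with N hN h2 h3
    have hN0 : (0 : ℝ) < N := by exact_mod_cast hN
    have hs : 0 < √(N : ℝ) := Real.sqrt_pos.2 hN0
    have hsq : √(N : ℝ) ^ 2 = N := Real.sq_sqrt hN0.le
    have ha : ∀ m : ℕ, ‖(lam (τ / √N) * u N) ^ m‖ ≤ 1 * 1 ^ m := fun m => by
      rw [norm_pow, norm_mul, hu1, mul_one, one_pow, mul_one]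
      exact pow_le_one₀ (norm_nonneg _) h2
    have hb : ∀ m : ℕ, ‖w N ^ m‖ ≤ 1 * 1 ^ m := fun m => by
      rw [norm_pow, one_pow, mul_one, hw, norm_cexp_gauss]
      refine pow_le_one₀ (Real.exp_pos _).le (Real.exp_le_one_iff.2 ?_)
      have : 0 ≤ V * (τ / √N) ^ 2 := by positivity
      linarith
    refine (norm_pow_sub_pow_le one_pos one_pos ha hb N).trans ?_
    rw [one_mul] at h3
    calc _ ≤ (1 : ℝ) ^ 2 / 1 * (N * 1 ^ N) * ‖(τ / √(N : ℝ)) ^ 3‖ := by gcongr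
      _ = √(N : ℝ) ^ 2 * (|τ| / √N) ^ 3 := by
        rw [hsq, norm_pow, Real.norm_eq_abs, abs_div, abs_of_pos hs]; ring
      _ = _ := by field_simp
  have l3 : Tendsto (fun N : ℕ => w N ^ N) atTop (𝓝 (Complex.exp (-(V * τ ^ 2 / 2)))) := by
    have h1 : Tendsto (fun N : ℕ => Complex.exp (-(V * τ ^ 2 / 2) +
        Complex.I * c * τ ^ 3 * (((√(N : ℝ))⁻¹ : ℝ) : ℂ))) atTop
        (𝓝 (Complex.exp (-(V * τ ^ 2 / 2) + Complex.I * c * τ ^ 3 * ((0 : ℝ) : ℂ)))) := by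
      have h2 := (Complex.continuous_ofReal.tendsto 0).comp hinv
      exact ((h2.const_mul _).const_add _).cexp
    rw [Complex.ofReal_zero, mul_zero, add_zero] at h1
    refine h1.congr' ?_
    filter_upwards [eventually_ge_atTop 1] with N hN
    have hN0 : (0 : ℝ) < N := by exact_mod_cast hN
    have hs : ((√(N : ℝ) : ℝ) : ℂ) ≠ 0 := by exact_mod_cast (Real.sqrt_pos.2 hN0).ne'
    have hsq : ((√(N : ℝ) : ℝ) : ℂ) ^ 2 = N := by exact_mod_cast Real.sq_sqrt hN0.le
    rw [hw, ← Complex.exp_nat_mul, ← hsq]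
    congr 1
    push_cast
    field_simp
  have l4 : Tendsto (fun N : ℕ => g (τ / √N)) atTop (𝓝 1) := by
    rw [← hg0]; exact hgc.tendsto.comp ht
  have := l1.add ((l2.add l3).mul l4)
  rw [zero_add, zero_add, mul_one] at this
  exact this.congr fun N => by ring

end Limit

/-! ### The limit theorem and the Edgeworth expansion -/

section Main

variable {Ω : Type*} [MeasurableSpace Ω] {P : Measure Ω} [IsProbabilityMeasure P]
  {X : ℕ → Ω → ℝ}

theorem satisfiesCLT_of_tendsto (hX : ∀ n, 1 ≤ n → AEMeasurable (X n) P) {A : ℝ} {V : ℝ≥0}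
    (h : ∀ τ : ℝ, Tendsto (fun N : ℕ => ∫ w : ℝ, Complex.exp (Complex.I * τ * w)
      ∂(P.map (normalizedSum X A N))) atTop (𝓝 (Complex.exp (-(V * τ ^ 2 / 2))))) :
    SatisfiesCLT P X A V := by
  refine ⟨aemeasurable_normalizedSum hX A, aemeasurable_id, ?_⟩
  refine ProbabilityMeasure.tendsto_iff_tendsto_charFun.2 fun τ => ?_
  simp only [ProbabilityMeasure.coe_mk, Measure.map_id]
  rw [charFun_gaussianReal]
  simp only [charFun_apply_real]
  have := h τ
  simpa [mul_comm, mul_left_comm, mul_assoc] using this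

/-- Passage from the Fourier estimate to the first order Edgeworth expansion. -/
theorem admitsEdgeworthExpansion_of_fourier (hX : ∀ n, 1 ≤ n → AEMeasurable (X n) P) {A b c : ℝ}
    {V : ℝ≥0} (hV : 0 < V)
    (h : ∀ T η : ℝ, 0 < T → 0 < η → ∀ᶠ N : ℕ in atTop, ∃ β : ℝ → ℝ,
      IntervalIntegrable β volume 0 (T * √N) ∧
      (∀ τ ∈ Set.Ioc 0 (T * √N), ‖(∫ w : ℝ, Complex.exp (Complex.I * τ * w)
          ∂(P.map (normalizedSum X A N))) - Complex.exp (-(V * τ ^ 2 / 2)) *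
          (1 + Complex.I * (b * τ + c * τ ^ 3) / (√N : ℝ))‖ ≤ τ * β τ) ∧
      ∫ τ in (0 : ℝ)..T * √N, β τ ≤ η / √N) :
    AdmitsEdgeworthExpansion P X A V 1 := by
  obtain ⟨p, q, M, hqi, hqM, hqp, hqf⟩ := exists_edgeworth_correction hV.ne' b c
  obtain ⟨K, hK, hess⟩ := exists_esseen_const
  set φ := gaussianPDFReal 0 V with hφ
  have hφi : Integrable φ := integrable_gaussianPDFReal 0 V
  have hφM := abs_polyGauss_le hV.ne' 1
  refine ⟨fun _ => p, fun ε hε => ?_⟩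
  obtain ⟨M₀, hM₀⟩ : ∃ M₀, ∀ x, |φ x| ≤ M₀ := ⟨_, fun x => by simpa [polyGauss] using hφM x⟩
  have hM0 : 0 ≤ M := (abs_nonneg _).trans (hqM 0)
  have hM₀0 : 0 ≤ M₀ := (abs_nonneg _).trans (hM₀ 0)
  -- A bound for the approximating density `φ + q/√N` that is uniform in `N ≥ 1`; the summand `1`
  -- makes it positive.
  set m := M₀ + M + 1 with hm
  have hm0 : 0 < m := by positivity
  -- With this cutoff the term `K m/(T√N)` equals `ε/(2√N)`; the Fourier integral, taken with `η =
  -- ε/(2K)`, supplies the other half.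
  set T := 2 * K * m / ε with hT
  have hT0 : 0 < T := by positivity
  filter_upwards [eventually_ge_atTop 1, h T (ε / (2 * K)) hT0 (by positivity)]
    with N hN ⟨β, hβi, hβ, hβI⟩ z
  have hN1 : (1 : ℝ) ≤ N := by exact_mod_cast hN
  have hs1 : 1 ≤ √(N : ℝ) := Real.one_le_sqrt.2 hN1
  have hs : 0 < √(N : ℝ) := by linarith
  have := Measure.isProbabilityMeasure_map (μ := P) (aemeasurable_normalizedSum hX A N)
  have hmain := hess (P.map (normalizedSum X A N)) (fun x => φ x + q x / √N) m (T * √N) β hm0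
    (by positivity) (hφi.add (hqi.div_const _)) (fun x => ?_) hβi (fun τ hτ => ?_) z
  · have hmeas : (P.map (normalizedSum X A N)).real (Set.Iic z) =
        P.real {ω | normalizedSum X A N ω ≤ z} := by
      rw [map_measureReal_apply_of_aemeasurable (aemeasurable_normalizedSum hX A N)
        measurableSet_Iic]
      rfl
    rw [hmeas, integral_add hφi.integrableOn (hqi.div_const _).integrableOn, integral_div,
      hqp] at hmain
    have hr1 : (N : ℝ) ^ (((1 : ℕ) : ℝ) / 2) = √N := by rw [Real.sqrt_eq_rpow]; norm_num
    have hr2 : (N : ℝ) ^ (-((1 : ℕ) : ℝ) / 2) = (√(N : ℝ))⁻¹ := by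
      rw [neg_div, Real.rpow_neg (by positivity), hr1]
    rw [Finset.Icc_self, Finset.sum_singleton, hr1, hr2]
    calc _ = |P.real {ω | normalizedSum X A N ω ≤ z} -
          ((∫ x in Set.Iic z, φ x) + p.eval z * φ z / √N)| := by congr 1; ring
      _ ≤ _ := hmain
      _ ≤ K * (ε / (2 * K) / √N + m / (T * √N)) := by gcongr
      _ = _ := by rw [hT]; field_simp; ring
  · calc |φ x + q x / √N| ≤ |φ x| + |q x / √N| := abs_add_le _ _
      _ ≤ M₀ + M := by
        gcongr
        · exact hM₀ x
        · rw [abs_div, abs_of_pos hs]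
          exact (div_le_self (abs_nonneg _) hs1).trans (hqM x)
      _ ≤ m := by linarith
  · have hfi : ∀ f : ℝ → ℝ, Integrable f →
        Integrable fun w : ℝ => Complex.exp (Complex.I * τ * w) * (f w : ℂ) := fun f hf =>
      hf.ofReal.bdd_mul (c := 1) (by fun_prop)
        (ae_of_all _ fun w => (norm_cexp_I_mul_mul τ w).le)
    have h1 : ∫ w : ℝ, Complex.exp (Complex.I * τ * w) * ((φ w + q w / √N : ℝ) : ℂ) =
        Complex.exp (-(V * τ ^ 2 / 2)) *
          (1 + Complex.I * (b * τ + c * τ ^ 3) / (√N : ℝ)) := by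
      calc _ = ∫ w : ℝ, (Complex.exp (Complex.I * τ * w) * φ w +
            Complex.exp (Complex.I * τ * w) * q w / (√N : ℝ)) := by
            congr 1; ext w; push_cast; ring
        _ = _ := by
            rw [integral_add (hfi _ hφi) ((hfi _ hqi).div_const _), integral_div, hqf,
              fourier_gaussianPDFReal hV.ne']
            ring
    rw [h1]
    exact hβ τ hτ

variable {B : Type*} [NormedAddCommGroup B] [NormedSpace ℂ B] [CompleteSpace B]

theorem exists_clt_and_edgeworth (hX : ∀ n, 1 ≤ n → AEMeasurable (X n) P)
    {L : ℝ → B →L[ℂ] B} {v : B} {ℓ : B →L[ℂ] ℂ} (hchar : CodesCharFun P X L v ℓ)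
    {s : ℕ} (hs : 3 ≤ s) (hA1 : AssumptionA1 L s) (hA2 : AssumptionA2 L)
    (hA3 : AssumptionA3 L) :
    ∃ (A : ℝ) (var : ℝ≥0), SatisfiesCLT P X A var ∧
      (0 < var → AdmitsEdgeworthExpansion P X A var 1) := by
  set ψ : ℕ → ℝ → ℂ := fun N t => ℓ ((L t ^ N) v) with hψ
  have hψ0 : ∀ N : ℕ, 1 ≤ N → ψ N 0 = 1 := fun N hN => by
    rw [hψ]; dsimp only; rw [← hchar N hN]; simp
  have hψ1 : ∀ N : ℕ, 1 ≤ N → ∀ t, ‖ψ N t‖ ≤ 1 := fun N hN t => by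
    rw [hψ]; dsimp only; rw [← hchar N hN]; exact norm_integral_cexp_le_one _ _
  have hψc : ∀ N : ℕ, 1 ≤ N → ∀ t, ψ N (-t) = (starRingEnd ℂ) (ψ N t) := fun N hN t => by
    rw [hψ]; dsimp only; rw [← hchar N hN, ← hchar N hN]; exact integral_cexp_neg _ _
  have : Nontrivial B := by
    refine ⟨v, 0, fun hv => ?_⟩
    have := hψ0 1 le_rfl
    simp [hψ, hv] at this
  obtain ⟨lam, g, δ, C, ρ, hlam, hg, hlam0, hδ, hC, hρ, hρ1, hexp⟩ :=
    exists_spectral_expansion hs hA1 hA2 v ℓ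
  have h1 : ∀ N : ℕ, 1 ≤ N → ∀ t : ℝ, |t| ≤ δ → ‖ψ N t - lam t ^ N * g t‖ ≤ C * ρ ^ N :=
    fun N hN t ht => (hexp N hN t ht).1
  have hg0 : g 0 = 1 := apply_zero_eq_one hψ0 hlam0 hδ hρ hρ1 h1
  -- At `t = 0` the remainder is `ψ N 0 - g 0 = 1 - 1 = 0`, so the bound on the increment of the
  -- remainder bounds the remainder itself.
  have h2 : ∀ N : ℕ, 1 ≤ N → ∀ t : ℝ, |t| ≤ δ →
      ‖ψ N t - lam t ^ N * g t‖ ≤ C * |t| * ρ ^ N := fun N hN t ht => by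
    have := (hexp N hN t ht).2
    rwa [show ℓ ((L 0 ^ N) v) = 1 from hψ0 N hN, hg0, sub_self, sub_zero] at this
  have hev := eventually_eigenvalue_properties hψ1 hψc hlam.continuousAt hg.continuousAt hlam0 hg0
    hδ hC hρ hρ1 h1
  obtain ⟨A, c, V, hAcV⟩ := exists_gaussian_expansion hlam hlam0 (hev.mono fun t ht => ht.2.1)
    (hev.mono fun t ht => ht.1)
  obtain ⟨b, hb⟩ := exists_linear_expansion hg hg0 (hev.mono fun t ht => ht.2.2)
  have hfour : ∀ N : ℕ, 1 ≤ N → ∀ τ : ℝ, ∫ w : ℝ, Complex.exp (Complex.I * τ * w)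
      ∂(P.map (normalizedSum X A N)) = ψ N (τ / √N) *
        Complex.exp (-(Complex.I * A * ((τ / √N : ℝ) : ℂ))) ^ N := fun N hN τ => by
    rw [fourier_map_normalizedSum hX A hN, hchar N hN]
  refine ⟨A, V, satisfiesCLT_of_tendsto hX fun τ => ?_, fun hV => ?_⟩
  · refine (tendsto_mul_cexp_pow V.2 hδ hρ hρ1 (hev.mono fun t ht => ht.1) hAcV hg.continuousAt hg0
      h1 τ).congr' ?_
    filter_upwards [eventually_ge_atTop 1] with N hN
    exact (hfour N hN τ).symm
  · refine admitsEdgeworthExpansion_of_fourier (b := b) (c := c) hX hV fun T η hT hη => ?_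
    filter_upwards [eventually_ge_atTop 1, eventually_fourier_estimate (NNReal.coe_pos.2 hV) hδ hC
      hρ hρ1 hAcV hb hg.continuousAt hg0 h2
      (fun δ T hδ => exists_exponential_decay hA1.continuous hA3 v ℓ hδ) hT hη]
      with N hN ⟨β, hβi, hβ, hβI⟩
    refine ⟨β, hβi, fun τ hτ => ?_, hβI⟩
    rw [hfour N hN]
    exact hβ τ hτ

end Main

end Edgeworth

end

theorem mainTheorem2
    {Ω : Type*} [MeasurableSpace Ω] (P : MeasureTheory.Measure Ω)
    [MeasureTheory.IsProbabilityMeasure P]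
    (X : ℕ → Ω → ℝ) (hX : ∀ n, 1 ≤ n → AEMeasurable (X n) P)
    {B : Type*} [NormedAddCommGroup B] [NormedSpace ℂ B] [CompleteSpace B]
    (L : ℝ → B →L[ℂ] B) (v : B) (ℓ : B →L[ℂ] ℂ)
    (hchar : Edgeworth.CodesCharFun P X L v ℓ)
    (s : ℕ) (hs : 3 ≤ s)
    (hA1 : Edgeworth.AssumptionA1 L s)
    (hA2 : Edgeworth.AssumptionA2 L)
    (hA3 : Edgeworth.AssumptionA3 L) :
    ∃ (A : ℝ) (var : NNReal), Edgeworth.SatisfiesCLT P X A var ∧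
      (0 < var → Edgeworth.AdmitsEdgeworthExpansion P X A var 1) :=
  Edgeworth.exists_clt_and_edgeworth hX hchar hs hA1 hA2 hA3
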